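/- Let $(V,g)$ be a finite-dimensional real vector space with a positive definite metric, $\dim V\ge 4$, and let $\mathcal T=\{K\in \mathrm{End}\,V \mid K^2=-1,\ g(K\cdot,K\cdot)=g(\cdot,\cdot)\}$ be its twistor space, regarded as a submanifold of $\mathrm{End}\,V$, so that $T_K\mathcal T=\{A\in\mathfrak o(V,g)\mid AK+KA=0\}$. Write $\mathfrak{gl}(\mathbb V)=\mathrm{End}\,V\times\mathcal T$ and $\mathfrak o(\mathbb V,g)=\mathfrak o(V,g)\times\mathcal T$ for the trivial bundles, $\phi$ for the section of $\mathfrak o(\mathbb V,g)$ with $\phi|_K=K$, $\Gamma$ for smooth sections, and $d$ for the trivial derivative of $\mathrm{End}\,V$-valued maps on $\mathcal T$. A skew algebroid $(E,[\cdot,\cdot],\psi)$ on $\mathcal T$ is a smooth vector bundle $E\to\mathcal T$ with a skew-symmetric $\mathbb R$-bilinear bracket on $\Gamma(E)$ and a smooth bundle map $\psi:E\to T\mathcal T$ such that $\psi([A,B])=[\psi(A),\psi(B)]_{Lie}$ and $[A,fB]=f[A,B]+\psi(A)[f]\,B$ for all $A,B\in\Gamma(E)$, $f\in C^\infty(\mathcal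 T)$. Fix $J\in\mathcal T$ and let $S\in\{\mathbb 1,\ J+\phi,\ J-\phi,\ [J,\phi]\}$. For $\gamma\in\{\pm J,\pm\phi\}$ let $\tilde\gamma$ be the unique element of $\{\pm J,\pm\phi\}$ with $\gamma S=S\tilde\gamma$; it is also the unique one with $S\gamma=\tilde\gamma S$. Let $E$ be one of $$\mathfrak o(\mathbb V,g),\quad \mathfrak o_{\{\phi\}}(\mathbb V)=\{A\in\mathfrak o(\mathbb V,g)\mid \phi A=-A\phi\},\quad \mathfrak u(\mathbb V,J)=\{A\in\mathfrak o(\mathbb V,g)\mid JA=AJ\},\quad \mathfrak u(\mathbb V,\phi)=\{A\in\mathfrak o(\mathbb V,g)\mid \phi A=A\phi\}.$$ If $E=\{A\in\mathfrak o(\mathbb V,g)\mid\gamma A=A\delta\}$ with $\gamma,\delta\in\{\pm J,\pm\phi\}$ as displayed, put $E^S=\{B\in\mathfrak o(\mathbb V,g)\mid\tilde\gamma B=B\tilde\delta\}$; if $E=\mathfrak o(\mathbb V,g)$, put $E^S=\mathfrak o(\mathbb V,g)$. Let $Q\in\Gamma(\mathfrak{gl}(\mathbb V))$ satisfy $Q^*=Q$,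 $[Q,J]=0$ and $[Q,\phi]=0$, let $F=QS$, and suppose that $$dQ_{[FCF,\phi]}=Q\,\bigl(dQ_{[SCS,\phi]}\bigr)\,Q\qquad\text{for all } C\in\Gamma(E^S).$$ Then, with $\psi:E^S\to T\mathcal T$, $\psi(A)=[FAF,\phi]$, there exists a skew bracket $[\cdot,\cdot]_F$ on $\Gamma(E^S)$ such that $(E^S,[\cdot,\cdot]_F,\psi)$ is a skew algebroid on $\mathcal T$. -/

import Mathlib

open scoped ContDiff InnerProductSpace

namespace Twistor

/-- A complex structure on the Euclidean space `V` compatible with its inner product. -/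
def IsCompatible {V : Type*} [NormedAddCommGroup V] [InnerProductSpace ℝ V]
    (K : V →L[ℝ] V) : Prop :=
  K * K = -1 ∧ ∀ x y : V, ⟪K x, K y⟫_ℝ = ⟪x, y⟫_ℝ

/-- The twistor space `𝒯(V)`, as a subset of the normed space `End V`. -/
def twistorSet (V : Type*) [NormedAddCommGroup V] [InnerProductSpace ℝ V] :
    Set (V →L[ℝ] V) :=
  {K | IsCompatible K}

/-- The twistor space `𝒯(V)`, as a type. -/
abbrev TwistorSpace (V : Type*) [NormedAddCommGroup V] [InnerProductSpace ℝ V] : Type _ :=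
  twistorSet V

section Calculus

variable {V : Type*} [NormedAddCommGroup V] [InnerProductSpace ℝ V]
variable {W : Type*} [NormedAddCommGroup W] [NormedSpace ℝ W]

/-- Smoothness near `K` of a map defined on the submanifold `𝒯(V) ⊆ End V`: near `K` it is the
restriction of a smooth map defined on an open subset of `End V`. -/
def SmoothAt (f : TwistorSpace V → W) (K : TwistorSpace V) : Prop :=
  ∃ (U : Set (V →L[ℝ] V)) (F : (V →L[ℝ] V) → W), IsOpen U ∧ (K : V →L[ℝ] V) ∈ U ∧
    ContDiffOn ℝ ∞ F U ∧ ∀ L : TwistorSpace V, (L : V →L[ℝ] V) ∈ U → F L = f L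

/-- Smooth maps on `𝒯(V)`. -/
def Smooth (f : TwistorSpace V → W) : Prop := ∀ K, SmoothAt f K

theorem SmoothAt.add {f g : TwistorSpace V → W} {K : TwistorSpace V}
    (hf : SmoothAt f K) (hg : SmoothAt g K) : SmoothAt (f + g) K := by
  obtain ⟨U, F, hU, hK, hF, h⟩ := hf
  obtain ⟨U', G, hU', hK', hG, h'⟩ := hg
  refine ⟨U ∩ U', F + G, hU.inter hU', ⟨hK, hK'⟩,
    (hF.mono Set.inter_subset_left).add (hG.mono Set.inter_subset_right), fun L hL => ?_⟩
  simp [h L hL.1, h' L hL.2]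

theorem SmoothAt.smul {f : TwistorSpace V → ℝ} {g : TwistorSpace V → W} {K : TwistorSpace V}
    (hf : SmoothAt f K) (hg : SmoothAt g K) : SmoothAt (fun L => f L • g L) K := by
  obtain ⟨U, F, hU, hK, hF, h⟩ := hf
  obtain ⟨U', G, hU', hK', hG, h'⟩ := hg
  refine ⟨U ∩ U', fun x => F x • G x, hU.inter hU', ⟨hK, hK'⟩,
    (hF.mono Set.inter_subset_left).smul (hG.mono Set.inter_subset_right), fun L hL => ?_⟩
  simp [h L hL.1, h' L hL.2]

theorem Smooth.const (w : W) : Smooth (fun _ : TwistorSpace V => w) := fun _ =>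
  ⟨Set.univ, fun _ => w, isOpen_univ, trivial, contDiffOn_const, fun _ _ => rfl⟩

/-- The derivative `df_X` at `K` of a map `f` on `𝒯(V)` along a vector `X` tangent to `𝒯(V)` at `K`.
For smooth `f` and tangent `X` it is the derivative of `f` along any curve in `𝒯(V)` through `K`
with velocity `X`, see `hasDerivAt_comp_curve` and `mem_tangent_iff` below. -/
noncomputable def tderiv (f : TwistorSpace V → W) (K : TwistorSpace V) (X : V →L[ℝ] V) : W :=
  fderivWithin ℝ (Function.extend Subtype.val f 0) (twistorSet V) K X

/-- The Lie bracket of vector fields on the submanifold `𝒯(V) ⊆ End V`; vector fields are regarded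
as `End V`-valued maps, and `[X, Y] = dY_X - dX_Y`. -/
noncomputable def lieBracket (X Y : TwistorSpace V → (V →L[ℝ] V)) (K : TwistorSpace V) :
    V →L[ℝ] V :=
  tderiv Y K (X K) - tderiv X K (Y K)

end Calculus

section Bundles

variable (V : Type*) [NormedAddCommGroup V] [InnerProductSpace ℝ V]

/-- `𝔬(V, g)`: the skew-adjoint endomorphisms. -/
def skew : Submodule ℝ (V →L[ℝ] V) where
  carrier := {A | ∀ x y : V, ⟪A x, y⟫_ℝ = -⟪x, A y⟫_ℝ}
  add_mem' {A B} hA hB x y := by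
    have h1 := hA x y
    have h2 := hB x y
    simp only [add_apply, inner_add_left, inner_add_right, h1, h2]
    ring
  zero_mem' x y := by simp
  smul_mem' c A hA x y := by
    have h1 := hA x y
    simp only [smul_apply, real_inner_smul_left, real_inner_smul_right, h1]
    ring

variable {V}

/-- The endomorphisms `A ∈ 𝔬(V, g)` with `P A = A R`. -/
def skewRel (P R : V →L[ℝ] V) : Submodule ℝ (V →L[ℝ] V) where
  carrier := {A | A ∈ skew V ∧ P * A = A * R}
  add_mem' {A B} hA hB := ⟨add_mem hA.1 hB.1, by rw [mul_add, add_mul, hA.2, hB.2]⟩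
  zero_mem' := ⟨zero_mem _, by simp⟩
  smul_mem' c A hA := ⟨Submodule.smul_mem _ c hA.1, by rw [mul_smul_comm, smul_mul_assoc, hA.2]⟩

/-- The tangent space `T_K 𝒯 = {A ∈ 𝔬(V, g) | {A, K} = 0}`, a subspace of `End V`; it consists of
the velocities of curves in `𝒯(V)` through `K`, see `mem_tangent_iff` below. -/
def tangent (K : TwistorSpace V) : Submodule ℝ (V →L[ℝ] V) :=
  skewRel (K : V →L[ℝ] V) (-K)

/-- A family of subspaces of `End V` over `𝒯(V)` is a smooth vector subbundle of
`𝔤𝔩(𝕍) = End V × 𝒯(V)`: it admits smooth local frames. -/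
def IsSubbundle (E : TwistorSpace V → Submodule ℝ (V →L[ℝ] V)) : Prop :=
  ∀ K, ∃ (U : Set (TwistorSpace V)) (r : ℕ) (e : Fin r → TwistorSpace V → (V →L[ℝ] V)),
    IsOpen U ∧ K ∈ U ∧ (∀ i, ∀ L ∈ U, SmoothAt (e i) L) ∧
    ∀ L ∈ U, LinearIndependent ℝ (fun i => e i L) ∧
      Submodule.span ℝ (Set.range fun i => e i L) = E L

/-- `Γ(E)`: the smooth sections of `E`. -/
def Sections (E : TwistorSpace V → Submodule ℝ (V →L[ℝ] V)) :
    Submodule ℝ (TwistorSpace V → (V →L[ℝ] V)) where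
  carrier := {A | Smooth A ∧ ∀ K, A K ∈ E K}
  add_mem' hA hB := ⟨fun K => (hA.1 K).add (hB.1 K), fun K => add_mem (hA.2 K) (hB.2 K)⟩
  zero_mem' := ⟨Smooth.const 0, fun _ => zero_mem _⟩
  smul_mem' c _ hA := ⟨fun K => (Smooth.const c K).smul (hA.1 K),
    fun K => Submodule.smul_mem _ c (hA.2 K)⟩

/-- The value `A|_K ∈ E_K` of a section. -/
def valueAt {E : TwistorSpace V → Submodule ℝ (V →L[ℝ] V)} (A : Sections E)
    (K : TwistorSpace V) : E K :=
  ⟨A.1 K, A.2.2 K⟩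

/-- The section `f A` for a smooth function `f` on `𝒯(V)`. -/
def fsmul {E : TwistorSpace V → Submodule ℝ (V →L[ℝ] V)} (f : TwistorSpace V → ℝ)
    (hf : Smooth f) (A : Sections E) : Sections E :=
  ⟨fun K => f K • A.1 K, fun K => (hf K).smul (A.2.1 K),
    fun K => Submodule.smul_mem _ (f K) (A.2.2 K)⟩

/-- The `End V`-valued map `K ↦ ψ_K(A|_K)`. -/
def applyAnchor {E : TwistorSpace V → Submodule ℝ (V →L[ℝ] V)}
    (ψ : ∀ K, E K →ₗ[ℝ] (V →L[ℝ] V)) (A : Sections E) : TwistorSpace V → (V →L[ℝ] V) :=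
  fun K => ψ K (valueAt A K)

/-- `(E, [·,·], ψ)` is a skew algebroid on `𝒯(V)`: `E` is a vector bundle, `ψ : E → T𝒯` is a smooth
bundle map, and the skew-symmetric `ℝ`-bilinear bracket on `Γ(E)` satisfies
`ψ([A, B]) = [ψ(A), ψ(B)]_Lie` and `[A, f B] = f [A, B] + ψ(A)[f] B`. -/
structure IsSkewAlgebroid (E : TwistorSpace V → Submodule ℝ (V →L[ℝ] V))
    (br : Sections E →ₗ[ℝ] Sections E →ₗ[ℝ] Sections E)
    (ψ : ∀ K, E K →ₗ[ℝ] (V →L[ℝ] V)) : Prop where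
  subbundle : IsSubbundle E
  anchor_tangent : ∀ K (a : E K), ψ K a ∈ tangent K
  anchor_smooth : ∀ A : Sections E, Smooth (applyAnchor ψ A)
  skew_symm : ∀ A B, br A B = -br B A
  anchor_bracket : ∀ A B K,
    applyAnchor ψ (br A B) K = lieBracket (applyAnchor ψ A) (applyAnchor ψ B) K
  leibniz : ∀ A B (f : TwistorSpace V → ℝ) (hf : Smooth f) K,
    (br A (fsmul f hf B)).1 K = f K • (br A B).1 K + tderiv f K (applyAnchor ψ A K) • B.1 K

/-- Names for the four sections `J, -J, φ, -φ` of `𝔬(𝕍, g)`. -/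
inductive Gen
  | J
  | negJ
  | phi
  | negPhi

/-- The section of `𝔬(𝕍, g)` named by an element of `{±J, ±φ}`; here `φ|_K = K`. -/
def Gen.eval (J : TwistorSpace V) : Gen → TwistorSpace V → (V →L[ℝ] V)
  | .J, _ => J
  | .negJ, _ => -J
  | .phi, K => K
  | .negPhi, K => -K

/-- Names for the four sections `1, J + φ, J - φ, [J, φ]` of `𝔤𝔩(𝕍)`. -/
inductive SType
  | one
  | plus
  | minus
  | comm

/-- The section of `𝔤𝔩(𝕍)` named by an element of `{1, J + φ, J - φ, [J, φ]}`. -/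
def SType.eval (J : TwistorSpace V) : SType → TwistorSpace V → (V →L[ℝ] V)
  | .one, _ => 1
  | .plus, K => J + K
  | .minus, K => J - K
  | .comm, K => J * K - K * J

/-- The element `γ̃ ∈ {±J, ±φ}` with `γ S = S γ̃`, equivalently `S γ = γ̃ S`; see `eval_mul_eval`,
`eval_mul_eval'` for these identities and `eq_tilde`, `eq_tilde'` for the uniqueness. -/
def SType.tilde : SType → Gen → Gen
  | .one, γ => γ
  | .plus, .J => .phi
  | .plus, .negJ => .negPhi
  | .plus, .phi => .J
  | .plus, .negPhi => .negJ
  | .minus, .J => .negPhi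
  | .minus, .negJ => .phi
  | .minus, .phi => .negJ
  | .minus, .negPhi => .J
  | .comm, .J => .negJ
  | .comm, .negJ => .J
  | .comm, .phi => .negPhi
  | .comm, .negPhi => .phi

/-- The bundles `𝔬(𝕍, g)` (`all`) and `{A ∈ 𝔬(𝕍, g) | γ A = A δ}` (`rel γ δ`). -/
inductive BType
  | all
  | rel (γ δ : Gen)

/-- The fibres of the bundle named by an element of `BType`. -/
def BType.fiber (J : TwistorSpace V) : BType → TwistorSpace V → Submodule ℝ (V →L[ℝ] V)
  | .all, _ => skew V
  | .rel γ δ, K => skewRel (γ.eval J K) (δ.eval J K)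

/-- `𝔲(𝕍, J) = {A | [A, J] = 0}`. -/
def BType.uJ : BType := .rel .J .J

/-- `𝔲(𝕍, φ) = {A | [A, φ] = 0}`. -/
def BType.uPhi : BType := .rel .phi .phi

/-- `𝔬_{φ}(𝕍) = {A | {A, φ} = 0}`. -/
def BType.oPhi : BType := .rel .phi .negPhi

/-- The bundle `E^S`: `{B | γ̃ B = B δ̃}` if `E = {A | γ A = A δ}`, and `𝔬(𝕍, g)^S = 𝔬(𝕍, g)`. -/
def BType.twist (S : SType) : BType → BType
  | .all => .all
  | .rel γ δ => .rel (S.tilde γ) (S.tilde δ)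

/-- The linear map `A ↦ [F A F, K]` on a subspace of `End V`. -/
def anchor (E : TwistorSpace V → Submodule ℝ (V →L[ℝ] V))
    (F : TwistorSpace V → (V →L[ℝ] V)) (K : TwistorSpace V) : E K →ₗ[ℝ] (V →L[ℝ] V) where
  toFun A := F K * A * F K * K - K * (F K * A * F K)
  map_add' A B := by
    simp only [Submodule.coe_add, mul_add, add_mul]
    abel
  map_smul' c A := by
    simp only [Submodule.coe_smul, mul_smul_comm, smul_mul_assoc, RingHom.id_apply, smul_sub]

end Bundles

section WellDefined

variable {V : Type*} [NormedAddCommGroup V] [InnerProductSpace ℝ V]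
variable {W : Type*} [NormedAddCommGroup W] [NormedSpace ℝ W]

theorem hasFDerivWithinAt_extend {f : TwistorSpace V → W} {K : TwistorSpace V}
    {U : Set (V →L[ℝ] V)} {F : (V →L[ℝ] V) → W} (hU : IsOpen U) (hK : (K : V →L[ℝ] V) ∈ U)
    (hF : ContDiffOn ℝ ∞ F U)
    (h : ∀ L : TwistorSpace V, (L : V →L[ℝ] V) ∈ U → F L = f L) :
    HasFDerivWithinAt (Function.extend Subtype.val f 0) (fderiv ℝ F K) (twistorSet V)
      (K : V →L[ℝ] V) := by
  have h1 : HasFDerivAt F (fderiv ℝ F K) (K : V →L[ℝ] V) :=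
    ((hF.contDiffAt (hU.mem_nhds hK)).differentiableAt (by simp)).hasFDerivAt
  have h2 : ∀ L : TwistorSpace V, (L : V →L[ℝ] V) ∈ U →
      Function.extend Subtype.val f 0 (L : V →L[ℝ] V) = F L := fun L hL => by
    rw [Subtype.val_injective.extend_apply, h L hL]
  refine h1.hasFDerivWithinAt.congr_of_eventuallyEq ?_ (h2 K hK)
  filter_upwards [self_mem_nhdsWithin, mem_nhdsWithin_of_mem_nhds (hU.mem_nhds hK)] with x hx hxU
  exact h2 ⟨x, hx⟩ hxU

/-- `df_X` is the derivative of `f` along every curve in `𝒯(V)` with velocity `X`. -/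
theorem hasDerivAt_comp_curve {f : TwistorSpace V → W} {c : ℝ → TwistorSpace V}
    {X : V →L[ℝ] V} (hf : SmoothAt f (c 0))
    (hc : HasDerivAt (fun t => (c t : V →L[ℝ] V)) X 0) :
    HasDerivAt (fun t => f (c t)) (tderiv f (c 0) X) 0 := by
  obtain ⟨U, F, hU, hK, hF, h⟩ := hf
  have h1 := (hasFDerivWithinAt_extend hU hK hF h).differentiableWithinAt.hasFDerivWithinAt
  have h2 := h1.comp_hasDerivAt (f := fun t => (c t : V →L[ℝ] V)) (0 : ℝ) hc
    (Filter.Eventually.of_forall fun t => (c t).2)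
  refine h2.congr_of_eventuallyEq (Filter.Eventually.of_forall fun t => ?_)
  simp

theorem coe_mul_self (K : TwistorSpace V) : (K : V →L[ℝ] V) * K = -1 := K.2.1

theorem apply_apply (K : TwistorSpace V) (x : V) : (K : V →L[ℝ] V) ((K : V →L[ℝ] V) x) = -x := by
  have := congrArg (fun A : V →L[ℝ] V => A x) (coe_mul_self K)
  simpa using this

theorem coe_mem_skew (K : TwistorSpace V) : (K : V →L[ℝ] V) ∈ skew V := fun x y => by
  have := K.2.2 x ((K : V →L[ℝ] V) y)
  rw [apply_apply, inner_neg_right] at this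
  linarith

/-- The tangent vectors at `K` are the velocities of curves in `𝒯(V)` through `K`. -/
theorem mem_tangent_iff [FiniteDimensional ℝ V] (K : TwistorSpace V) (X : V →L[ℝ] V) :
    X ∈ tangent K ↔ ∃ c : ℝ → TwistorSpace V, c 0 = K ∧
      HasDerivAt (fun t => (c t : V →L[ℝ] V)) X 0 := by
  have : CompleteSpace V := FiniteDimensional.complete ℝ V
  let : NormedAlgebra ℚ (V →L[ℝ] V) := NormedAlgebra.restrictScalars ℚ ℝ (V →L[ℝ] V)
  constructor
  · rintro ⟨hX, hXK⟩
    set k : V →L[ℝ] V := (K : V →L[ℝ] V) with hk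
    have hkk : k * k = -1 := coe_mul_self K
    have hXK' : k * X = -(X * k) := by rw [hXK]; simp
    obtain ⟨Z, hZ⟩ : ∃ Z : V →L[ℝ] V, Z = -(X * k) := ⟨_, rfl⟩
    have hZs : ∀ x y : V, ⟪Z x, y⟫_ℝ = -⟪x, Z y⟫_ℝ := fun x y => by
      have e1 : Z y = k (X y) := by rw [hZ, ← hXK']; rfl
      have e2 : Z x = -(X (k x)) := by rw [hZ]; rfl
      rw [e1, e2, inner_neg_left, hX, ← neg_neg (⟪k x, X y⟫_ℝ), show ⟪k x, X y⟫_ℝ = -⟪x, k (X y)⟫_ℝ from coe_mem_skew K x (X y)]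
      simp
    have hZk : Z * k = -(k * Z) := by
      have e1 : Z * k = X := by rw [hZ, neg_mul, mul_assoc, hkk]; simp
      have e2 : k * Z = -X := by rw [hZ, ← hXK', ← mul_assoc, hkk]; simp
      rw [e1, e2, neg_neg]
    have hZsk : Z ∈ skewAdjoint (V →L[ℝ] V) := by
      rw [skewAdjoint.mem_iff]
      refine ContinuousLinearMap.ext fun x => ext_inner_right ℝ fun y => ?_
      rw [ContinuousLinearMap.star_eq_adjoint, ContinuousLinearMap.adjoint_inner_left,
        neg_apply, inner_neg_left, hZs x y, neg_neg]
    have hcomm : ∀ t : ℝ, k * NormedSpace.exp (t • Z) = NormedSpace.exp (-(t • Z)) * k := by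
      intro t
      have : SemiconjBy k (t • Z) (-(t • Z)) := by
        unfold SemiconjBy
        rw [mul_smul_comm, neg_mul, smul_mul_assoc, hZk, smul_neg, neg_neg]
      exact this.exp_right
    have hu : ∀ t : ℝ, NormedSpace.exp (t • Z) ∈ unitary (V →L[ℝ] V) := fun t =>
      NormedSpace.exp_mem_unitary_of_mem_skewAdjoint (skewAdjoint.smul_mem t hZsk)
    have hexp : ∀ t : ℝ, NormedSpace.exp (t • Z) * NormedSpace.exp (-(t • Z)) = 1 := fun t => by
      rw [← NormedSpace.exp_add_of_commute (Commute.neg_right (Commute.refl _))]; simp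
    refine ⟨fun t => ⟨NormedSpace.exp (t • Z) * k, ?_, ?_⟩, ?_, ?_⟩
    · rw [mul_assoc, ← mul_assoc k, hcomm, mul_assoc (NormedSpace.exp (-(t • Z))), ← mul_assoc,
        hexp, one_mul, hkk]
    · intro x y
      have h1 := (Unitary.mem_iff.1 (hu t)).1
      rw [mul_apply_eq_comp, mul_apply_eq_comp,
        ← ContinuousLinearMap.adjoint_inner_right, ← ContinuousLinearMap.star_eq_adjoint,
        ← mul_apply_eq_comp, h1, one_apply_eq_self]
      exact K.2.2 x y
    · apply Subtype.ext; simp [hk]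
    · have h0 := (hasDerivAt_exp_smul_const (𝕂 := ℝ) Z (0 : ℝ)).mul_const k
      have : NormedSpace.exp ((0 : ℝ) • Z) * Z * k = X := by
        rw [zero_smul, NormedSpace.exp_zero, one_mul, hZ, neg_mul, mul_assoc, hkk]; simp
      rw [this] at h0
      exact h0
  · rintro ⟨c, rfl, hc⟩
    refine ⟨fun x y => ?_, ?_⟩
    · have h1 : HasDerivAt (fun t => ⟪(c t : V →L[ℝ] V) x, y⟫_ℝ) (⟪X x, y⟫_ℝ) 0 := by
        have := (hc.clm_apply (hasDerivAt_const (0 : ℝ) x)).inner ℝ (hasDerivAt_const (0 : ℝ) y)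
        simpa using this
      have h2 : HasDerivAt (fun t => -⟪x, (c t : V →L[ℝ] V) y⟫_ℝ) (-⟪x, X y⟫_ℝ) 0 := by
        have := ((hasDerivAt_const (0 : ℝ) x).inner ℝ
          (hc.clm_apply (hasDerivAt_const (0 : ℝ) y))).neg
        simp only [inner_zero_left, add_zero, map_zero] at this
        exact this
      have h3 : (fun t => ⟪(c t : V →L[ℝ] V) x, y⟫_ℝ) = fun t => -⟪x, (c t : V →L[ℝ] V) y⟫_ℝ :=
        funext fun t => coe_mem_skew (c t) x y
      rw [h3] at h1
      exact h1.unique h2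
    · have h1 := hc.mul hc
      have h2 : ((fun t => (c t : V →L[ℝ] V)) * fun t => (c t : V →L[ℝ] V)) = fun _ => -1 :=
        funext fun t => coe_mul_self (c t)
      rw [h2] at h1
      have := h1.unique (hasDerivAt_const (0 : ℝ) (-1 : V →L[ℝ] V))
      rw [mul_neg]
      exact eq_neg_of_add_eq_zero_right this

theorem eval_mul_eval (J K : TwistorSpace V) (S : SType) (γ : Gen) :
    γ.eval J K * S.eval J K = S.eval J K * (S.tilde γ).eval J K := by
  ext x
  cases S <;> cases γ <;>
    simp [Gen.eval, SType.eval, SType.tilde, apply_apply] <;> abel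

theorem eval_mul_eval' (J K : TwistorSpace V) (S : SType) (γ : Gen) :
    S.eval J K * γ.eval J K = (S.tilde γ).eval J K * S.eval J K := by
  ext x
  cases S <;> cases γ <;>
    simp [Gen.eval, SType.eval, SType.tilde, apply_apply] <;> abel

theorem exists_anticommuting [FiniteDimensional ℝ V] (hdim : 4 ≤ Module.finrank ℝ V)
    (J : TwistorSpace V) : ∃ (K : TwistorSpace V) (e : V), e ≠ 0 ∧
      (J : V →L[ℝ] V) ((K : V →L[ℝ] V) e) = -(K : V →L[ℝ] V) ((J : V →L[ℝ] V) e) := by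
  set j : V →L[ℝ] V := (J : V →L[ℝ] V) with hj
  have hsk : ∀ x y : V, ⟪j x, y⟫_ℝ = -⟪x, j y⟫_ℝ := coe_mem_skew J
  have hjx : ∀ x : V, ⟪j x, x⟫_ℝ = 0 := fun x => by
    have := hsk x x
    rw [real_inner_comm x (j x)] at this
    linarith [real_inner_comm x (j x)]
  have hnorm : ∀ x : V, ‖j x‖ = ‖x‖ := fun x => by
    have := J.2.2 x x
    rw [real_inner_self_eq_norm_sq, real_inner_self_eq_norm_sq] at this
    exact (sq_eq_sq₀ (norm_nonneg _) (norm_nonneg _)).1 this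
  have : Nontrivial V := Module.nontrivial_of_finrank_pos (R := ℝ) (by omega)
  obtain ⟨a, ha⟩ := exists_norm_eq V (zero_le_one' ℝ)
  have hspan : Module.finrank ℝ (Submodule.span ℝ (Set.range ![a, j a])) ≤ 2 := by
    have := finrank_range_le_card (R := ℝ) ![a, j a]
    rwa [Fintype.card_fin] at this
  have hperp := Submodule.finrank_add_finrank_orthogonal
    (Submodule.span ℝ (Set.range ![a, j a]))
  have : Nontrivial (Submodule.span ℝ (Set.range ![a, j a]))ᗮ :=
    Module.nontrivial_of_finrank_pos (R := ℝ) (by omega)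
  obtain ⟨b', hb'⟩ :=
    exists_norm_eq (Submodule.span ℝ (Set.range ![a, j a]))ᗮ (zero_le_one' ℝ)
  obtain ⟨b, hb⟩ := b'
  have hb1 : ‖b‖ = 1 := hb'
  have hab : ⟪a, b⟫_ℝ = 0 := Submodule.mem_orthogonal _ _ |>.1 hb a
    (Submodule.subset_span ⟨0, rfl⟩)
  have hjab : ⟪j a, b⟫_ℝ = 0 := Submodule.mem_orthogonal _ _ |>.1 hb (j a)
    (Submodule.subset_span ⟨1, rfl⟩)
  have hfix : ∀ v x : V, ⟪v, x⟫_ℝ = 0 → (Submodule.span ℝ {v})ᗮ.reflection x = x :=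
    fun v x h => Submodule.reflection_mem_subspace_eq_self
      (Submodule.mem_orthogonal_singleton_iff_inner_right.2 h)
  set R₁ := (Submodule.span ℝ {j a - b})ᗮ.reflection with hR₁
  set R₂ := (Submodule.span ℝ {b})ᗮ.reflection with hR₂
  have r1 : R₁ (j a) = b := Submodule.reflection_sub (by rw [hnorm, ha, hb1])
  have r1' : R₁ b = j a := by rw [← r1, hR₁, Submodule.reflection_reflection]
  have r2 : R₁ a = a := hfix _ _ (by rw [inner_sub_left, hjx, real_inner_comm, hab, sub_zero])
  have r3 : R₁ (j b) = j b := hfix _ _ (by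
    have : ⟪b, j b⟫_ℝ = 0 := by rw [real_inner_comm, hjx]
    rw [inner_sub_left, J.2.2, hab, this, sub_zero])
  have s1 : R₂ b = -b := Submodule.reflection_orthogonalComplement_singleton_eq_neg b
  have s2 : R₂ a = a := hfix _ _ (by rw [real_inner_comm, hab])
  have s3 : R₂ (j a) = j a := hfix _ _ (by rw [real_inner_comm, hjab])
  have s4 : R₂ (j b) = j b := hfix _ _ (by rw [real_inner_comm, hjx])
  let k : V →L[ℝ] V := (R₁ : V →L[ℝ] V) * (R₂ : V →L[ℝ] V) * j * (R₂ : V →L[ℝ] V) *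
    (R₁ : V →L[ℝ] V)
  have hkx : ∀ x, k x = R₁ (R₂ (j (R₂ (R₁ x)))) := fun x => rfl
  have hk : IsCompatible k := by
    refine ⟨?_, fun x y => ?_⟩
    · ext x
      rw [mul_apply_eq_comp, hkx, hkx, hR₁, hR₂]
      simp only [Submodule.reflection_reflection]
      rw [hj, apply_apply]
      simp [Submodule.reflection_reflection]
    · rw [hkx, hkx, LinearIsometryEquiv.inner_map_map, LinearIsometryEquiv.inner_map_map, J.2.2,
        LinearIsometryEquiv.inner_map_map, LinearIsometryEquiv.inner_map_map]
  refine ⟨⟨k, hk⟩, a, fun h => by simp [h] at ha, ?_⟩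
  change j (k a) = -k (j a)
  rw [hkx, hkx, r2, s2, s3, r1, s1, map_neg, map_neg, map_neg, s4, r3, neg_neg]

/-- On vectors where `J` and `K` anticommute, every `S` is injective. -/
theorem SType.eq_zero_of_eval {J K : TwistorSpace V} {w : V}
    (hw : (J : V →L[ℝ] V) ((K : V →L[ℝ] V) w) = -(K : V →L[ℝ] V) ((J : V →L[ℝ] V) w))
    (S : SType) (h : S.eval J K w = 0) : w = 0 := by
  have h2 := congrArg (S.eval J K) h
  cases S
  · simpa [SType.eval] using h
  · simp only [SType.eval, add_apply, map_add, apply_apply, hw, map_zero] at h2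
    have : (2 : ℝ) • w = 0 := by rw [two_smul, ← neg_eq_zero, ← h2]; abel
    simpa using this
  · simp only [SType.eval, sub_apply, map_sub, apply_apply, hw, map_zero] at h2
    have : (2 : ℝ) • w = 0 := by rw [two_smul, ← neg_eq_zero, ← h2]; abel
    simpa using this
  · simp only [SType.eval, sub_apply, mul_apply_eq_comp, hw] at h
    have h3 : (2 : ℝ) • (K : V →L[ℝ] V) ((J : V →L[ℝ] V) w) = 0 := by
      rw [two_smul, ← neg_eq_zero, ← h]; abel
    have h4 : (K : V →L[ℝ] V) ((J : V →L[ℝ] V) w) = 0 := by simpa using h3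
    have h5 := congrArg (fun x => (J : V →L[ℝ] V) ((K : V →L[ℝ] V) x)) h4
    simpa [apply_apply] using h5

/-- On nonzero vectors where `J` and `K` anticommute, `J, -J, K, -K` are pairwise distinct. -/
theorem Gen.eq_of_eval {J K : TwistorSpace V} {w : V}
    (hw : (J : V →L[ℝ] V) ((K : V →L[ℝ] V) w) = -(K : V →L[ℝ] V) ((J : V →L[ℝ] V) w))
    (h0 : w ≠ 0) (γ γ' : Gen) (h : γ.eval J K w = γ'.eval J K w) : γ = γ' := by
  have key : ∀ u : V, (2 : ℝ) • u = 0 → u = 0 := fun u hu => by simpa using hu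
  have hJ : (J : V →L[ℝ] V) w ≠ 0 := fun h1 => h0 (by
    rw [← neg_eq_zero, ← apply_apply J w, h1, map_zero])
  have hK : (K : V →L[ℝ] V) w ≠ 0 := fun h1 => h0 (by
    rw [← neg_eq_zero, ← apply_apply K w, h1, map_zero])
  have hp : (J : V →L[ℝ] V) w + (K : V →L[ℝ] V) w ≠ 0 := fun h1 => h0 (by
    exact SType.eq_zero_of_eval hw .plus h1)
  have hm : (J : V →L[ℝ] V) w - (K : V →L[ℝ] V) w ≠ 0 := fun h1 => h0 (by
    exact SType.eq_zero_of_eval hw .minus h1)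
  cases γ <;> cases γ' <;> first
    | rfl
    | (exfalso
       simp only [Gen.eval, neg_apply] at h
       first
         | (apply hm; rw [h]; simp; done)
         | (apply hm; rw [← h]; simp; done)
         | (apply hp; rw [h]; simp; done)
         | (apply hp; rw [← h]; simp; done)
         | (apply hm; rw [neg_inj.1 h]; simp; done)
         | (apply hJ; apply key; rw [two_smul]; nth_rewrite 1 [h]; simp; done)
         | (apply hJ; apply key; rw [two_smul]; nth_rewrite 1 [← h]; simp; done)
         | (apply hK; apply key; rw [two_smul]; nth_rewrite 1 [h]; simp; done)
         | (apply hK; apply key; rw [two_smul]; nth_rewrite 1 [← h]; simp; done))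

/-- `γ̃` is the only element of `{±J, ±φ}` with `γ S = S γ̃` on `𝒯(V)`. -/
theorem eq_tilde [FiniteDimensional ℝ V] (hdim : 4 ≤ Module.finrank ℝ V) (J : TwistorSpace V)
    (S : SType) (γ γ' : Gen)
    (h : ∀ K, γ.eval J K * S.eval J K = S.eval J K * γ'.eval J K) : γ' = S.tilde γ := by
  obtain ⟨K, e, he, hJK⟩ := exists_anticommuting hdim J
  have h1 := h K
  rw [eval_mul_eval] at h1
  have h2 := congrArg (fun A : V →L[ℝ] V => A e) h1
  simp only [mul_apply_eq_comp] at h2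
  refine (Gen.eq_of_eval hJK he _ _ (sub_eq_zero.1 ?_)).symm
  refine SType.eq_zero_of_eval (J := J) (K := K) ?_ S (by rw [map_sub, h2, sub_self])
  have hJ : ∀ γ : Gen, (J : V →L[ℝ] V) ((K : V →L[ℝ] V) (γ.eval J K e)) =
      -(K : V →L[ℝ] V) ((J : V →L[ℝ] V) (γ.eval J K e)) := by
    have t1 : (K : V →L[ℝ] V) ((J : V →L[ℝ] V) e) = -(J : V →L[ℝ] V) ((K : V →L[ℝ] V) e) := by
      rw [hJK, neg_neg]
    have t2 : (K : V →L[ℝ] V) ((J : V →L[ℝ] V) ((K : V →L[ℝ] V) e)) = (J : V →L[ℝ] V) e := by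
      rw [hJK, map_neg, apply_apply, neg_neg]
    intro γ
    cases γ <;> simp [Gen.eval, apply_apply, t1, t2]
  rw [map_sub, map_sub, hJ, hJ, map_sub, map_sub]
  abel

/-- `γ̃` is the only element of `{±J, ±φ}` with `S γ = γ̃ S` on `𝒯(V)`. -/
theorem eq_tilde' [FiniteDimensional ℝ V] (hdim : 4 ≤ Module.finrank ℝ V) (J : TwistorSpace V)
    (S : SType) (γ γ' : Gen)
    (h : ∀ K, S.eval J K * γ.eval J K = γ'.eval J K * S.eval J K) : γ' = S.tilde γ := by
  obtain ⟨K, e, he, hJK⟩ := exists_anticommuting hdim J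
  have h1 := h K
  rw [eval_mul_eval'] at h1
  have h2 := congrArg (fun A : V →L[ℝ] V => A e) h1
  simp only [mul_apply_eq_comp] at h2
  refine (Gen.eq_of_eval (J := J) (K := K) (w := S.eval J K e) ?_
    (fun h0 => he (SType.eq_zero_of_eval hJK S h0)) _ _ h2).symm
  have t1 : (K : V →L[ℝ] V) ((J : V →L[ℝ] V) e) = -(J : V →L[ℝ] V) ((K : V →L[ℝ] V) e) := by
    rw [hJK, neg_neg]
  have t2 : (K : V →L[ℝ] V) ((J : V →L[ℝ] V) ((K : V →L[ℝ] V) e)) = (J : V →L[ℝ] V) e := by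
    rw [hJK, map_neg, apply_apply, neg_neg]
  cases S <;> simp [SType.eval, apply_apply, t1, t2] <;> abel

end WellDefined

end Twistor

/-
For sections `a`, `b` of `𝔬(𝕍, g)` the vector fields `[a, φ]` and `[b, φ]` on `𝒯` have the Lie
bracket `[c, φ]` with `c = db_{[a, φ]} - da_{[b, φ]} - [a, b]`, and for each of the four bundles `E`
the map `c` may be replaced by its projection to `E` when `a, b ∈ Γ(E)`.

Since `Q` commutes with `J` and `φ`, `F = Q S` exchanges `γ` and `γ̃` just as `S` does, so that
`A ↦ F A F` maps `E^S` to `E` and is compatible with the projections to these bundles. It remains to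
write `c` as `F C F` when `a = F A F` and `b = F B F`, which is possible as soon as
`dF_{[F A F, φ]} = F Λ_A` for some `Λ_A`: then also `dF_{[F A F, φ]} = Λ_A* F`, because `F* = ±F`,
and `C` is the skew-symmetrisation of `dB_{[F A F, φ]} + Λ_A B + B Λ_A* - A F² B`. The condition on
`dQ` provides `Λ_A = dQ_{[S A S, φ]} Q + M_A S Q²`, where `M_A` is given by
`dS_{[G A G, φ]} = G M_A G`, an identity which holds for `G = S` and `G = F` alike.
-/

namespace Twistor

section Smoothness

variable {V : Type*} [NormedAddCommGroup V] [InnerProductSpace ℝ V]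
variable {W : Type*} [NormedAddCommGroup W] [NormedSpace ℝ W]
variable {W' : Type*} [NormedAddCommGroup W'] [NormedSpace ℝ W']

namespace Smooth

theorem continuous {f : TwistorSpace V → W} (hf : Smooth f) : Continuous f :=
  continuous_iff_continuousAt.2 fun K => by
    obtain ⟨U, F, hU, hK, hF, h⟩ := hf K
    have hFK : ContinuousAt (fun L : TwistorSpace V => F L) K :=
      (hF.contDiffAt (hU.mem_nhds hK)).continuousAt.comp continuousAt_subtype_val
    refine hFK.congr ?_
    filter_upwards [continuousAt_subtype_val.preimage_mem_nhds (hU.mem_nhds hK)] with L hL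
    exact h L hL

theorem coe : Smooth (fun K : TwistorSpace V => (K : V →L[ℝ] V)) := fun _ =>
  ⟨Set.univ, id, isOpen_univ, trivial, contDiffOn_id, fun _ _ => rfl⟩

theorem add {f g : TwistorSpace V → W} (hf : Smooth f) (hg : Smooth g) :
    Smooth (fun K => f K + g K) := fun K => (hf K).add (hg K)

theorem const_smul {f : TwistorSpace V → W} (a : ℝ) (hf : Smooth f) :
    Smooth (fun K => a • f K) := fun K => (Smooth.const a K).smul (hf K)

theorem clm_comp (T : W →L[ℝ] W') {f : TwistorSpace V → W} (hf : Smooth f) :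
    Smooth (fun K => T (f K)) := fun K => by
  obtain ⟨U, F, hU, hK, hF, h⟩ := hf K
  exact ⟨U, fun x => T (F x), hU, hK, T.contDiff.comp_contDiffOn hF,
    fun L hL => congrArg T (h L hL)⟩

theorem neg {f : TwistorSpace V → W} (hf : Smooth f) : Smooth (fun K => -f K) :=
  hf.clm_comp (-ContinuousLinearMap.id ℝ W)

theorem sub {f g : TwistorSpace V → W} (hf : Smooth f) (hg : Smooth g) :
    Smooth (fun K => f K - g K) := by
  simpa only [sub_eq_add_neg] using hf.add hg.neg

theorem mul {f g : TwistorSpace V → (V →L[ℝ] V)} (hf : Smooth f) (hg : Smooth g) :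
    Smooth (fun K => f K * g K) := fun K => by
  obtain ⟨U, F, hU, hK, hF, h⟩ := hf K
  obtain ⟨U', G, hU', hK', hG, h'⟩ := hg K
  exact ⟨U ∩ U', fun x => F x * G x, hU.inter hU', ⟨hK, hK'⟩,
    (hF.mono Set.inter_subset_left).mul (hG.mono Set.inter_subset_right),
    fun L hL => congrArg₂ (· * ·) (h L hL.1) (h' L hL.2)⟩

theorem lie {f g : TwistorSpace V → (V →L[ℝ] V)} (hf : Smooth f) (hg : Smooth g) :
    Smooth (fun K => ⁅f K, g K⁆) := (hf.mul hg).sub (hg.mul hf)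

protected theorem star [CompleteSpace V] {f : TwistorSpace V → (V →L[ℝ] V)} (hf : Smooth f) :
    Smooth (fun K => star (f K)) :=
  hf.clm_comp (starL' ℝ : (V →L[ℝ] V) ≃L[ℝ] (V →L[ℝ] V)).toContinuousLinearMap

end Smooth

end Smoothness

local instance completeSpace_of_finiteDimensional {V : Type*} [NormedAddCommGroup V]
    [InnerProductSpace ℝ V] [FiniteDimensional ℝ V] : CompleteSpace V :=
  FiniteDimensional.complete ℝ V

attribute [local instance] LieRing.ofAssociativeRing

section Derivatives

variable {V : Type*} [NormedAddCommGroup V] [InnerProductSpace ℝ V] [FiniteDimensional ℝ V]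
variable {W : Type*} [NormedAddCommGroup W] [NormedSpace ℝ W]
variable {W' : Type*} [NormedAddCommGroup W'] [NormedSpace ℝ W']
variable {K : TwistorSpace V} {X : V →L[ℝ] V}

theorem tderiv_eq_fderiv (hX : X ∈ tangent K) {f : TwistorSpace V → W} {U : Set (V →L[ℝ] V)}
    {F : (V →L[ℝ] V) → W} (hU : IsOpen U) (hK : (K : V →L[ℝ] V) ∈ U) (hF : ContDiffOn ℝ ∞ F U)
    (h : ∀ L : TwistorSpace V, (L : V →L[ℝ] V) ∈ U → F L = f L) :
    tderiv f K X = fderiv ℝ F K X := by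
  obtain ⟨c, rfl, hc⟩ := (mem_tangent_iff K X).1 hX
  have hFc : HasFDerivAt F (fderiv ℝ F (c 0)) (c 0 : V →L[ℝ] V) :=
    ((hF.contDiffAt (hU.mem_nhds hK)).differentiableAt (by simp)).hasFDerivAt
  refine (hasDerivAt_comp_curve ⟨U, F, hU, hK, hF, h⟩ hc).unique
    ((hFc.comp_hasDerivAt (f := fun t => (c t : V →L[ℝ] V)) (0 : ℝ) hc).congr_of_eventuallyEq ?_)
  filter_upwards [hc.continuousAt.preimage_mem_nhds (hU.mem_nhds hK)] with t ht
  exact (h (c t) ht).symm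

protected theorem Smooth.tderiv {f : TwistorSpace V → W} (hf : Smooth f)
    {X : TwistorSpace V → (V →L[ℝ] V)} (hX : Smooth X) (hXt : ∀ K, X K ∈ tangent K) :
    Smooth (fun K => tderiv f K (X K)) := fun K => by
  obtain ⟨U, F, hU, hK, hF, h⟩ := hf K
  obtain ⟨U', G, hU', hK', hG, h'⟩ := hX K
  refine ⟨U ∩ U', fun x => fderiv ℝ F x (G x), hU.inter hU', ⟨hK, hK'⟩,
    ((hF.fderiv_of_isOpen hU (by simp)).mono Set.inter_subset_left).clm_apply
      (hG.mono Set.inter_subset_right), fun L hL => ?_⟩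
  simp only [h' L hL.2, tderiv_eq_fderiv (hXt L) hU hL.1 hF h]

theorem tderiv_add (hX : X ∈ tangent K) {f g : TwistorSpace V → W} (hf : Smooth f)
    (hg : Smooth g) : tderiv (fun L => f L + g L) K X = tderiv f K X + tderiv g K X := by
  obtain ⟨c, rfl, hc⟩ := (mem_tangent_iff K X).1 hX
  exact (hasDerivAt_comp_curve (hf.add hg _) hc).unique
    ((hasDerivAt_comp_curve (hf _) hc).add (hasDerivAt_comp_curve (hg _) hc))

theorem tderiv_smul (hX : X ∈ tangent K) {f : TwistorSpace V → ℝ} {g : TwistorSpace V → W}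
    (hf : Smooth f) (hg : Smooth g) :
    tderiv (fun L => f L • g L) K X = f K • tderiv g K X + tderiv f K X • g K := by
  obtain ⟨c, rfl, hc⟩ := (mem_tangent_iff K X).1 hX
  exact (hasDerivAt_comp_curve ((hf _).smul (hg _)) hc).unique
    ((hasDerivAt_comp_curve (hf _) hc).smul (hasDerivAt_comp_curve (hg _) hc))

theorem tderiv_mul (hX : X ∈ tangent K) {f g : TwistorSpace V → (V →L[ℝ] V)}
    (hf : Smooth f) (hg : Smooth g) :
    tderiv (fun L => f L * g L) K X = tderiv f K X * g K + f K * tderiv g K X := by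
  obtain ⟨c, rfl, hc⟩ := (mem_tangent_iff K X).1 hX
  exact (hasDerivAt_comp_curve (hf.mul hg _) hc).unique
    ((hasDerivAt_comp_curve (hf _) hc).mul (hasDerivAt_comp_curve (hg _) hc))

theorem tderiv_const (hX : X ∈ tangent K) (w : W) : tderiv (fun _ => w) K X = 0 := by
  obtain ⟨c, rfl, hc⟩ := (mem_tangent_iff K X).1 hX
  exact (hasDerivAt_comp_curve (Smooth.const w _) hc).unique (hasDerivAt_const _ _)

theorem tderiv_coe (hX : X ∈ tangent K) :
    tderiv (fun L : TwistorSpace V => (L : V →L[ℝ] V)) K X = X := by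
  obtain ⟨c, rfl, hc⟩ := (mem_tangent_iff K X).1 hX
  exact (hasDerivAt_comp_curve (Smooth.coe _) hc).unique hc

theorem tderiv_clm_comp (hX : X ∈ tangent K) (T : W →L[ℝ] W') {f : TwistorSpace V → W}
    (hf : Smooth f) : tderiv (fun L => T (f L)) K X = T (tderiv f K X) := by
  obtain ⟨c, rfl, hc⟩ := (mem_tangent_iff K X).1 hX
  exact (hasDerivAt_comp_curve (hf.clm_comp T _) hc).unique
    (T.hasFDerivAt.comp_hasDerivAt (0 : ℝ) (hasDerivAt_comp_curve (hf _) hc))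

theorem tderiv_star (hX : X ∈ tangent K) {f : TwistorSpace V → (V →L[ℝ] V)} (hf : Smooth f) :
    tderiv (fun L => star (f L)) K X = star (tderiv f K X) :=
  tderiv_clm_comp hX (starL' ℝ : (V →L[ℝ] V) ≃L[ℝ] (V →L[ℝ] V)).toContinuousLinearMap hf

theorem tderiv_sub (hX : X ∈ tangent K) {f g : TwistorSpace V → W} (hf : Smooth f)
    (hg : Smooth g) : tderiv (fun L => f L - g L) K X = tderiv f K X - tderiv g K X := by
  obtain ⟨c, rfl, hc⟩ := (mem_tangent_iff K X).1 hX
  exact (hasDerivAt_comp_curve (hf.sub hg _) hc).unique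
    ((hasDerivAt_comp_curve (hf _) hc).sub (hasDerivAt_comp_curve (hg _) hc))

theorem tderiv_lie (hX : X ∈ tangent K) {f g : TwistorSpace V → (V →L[ℝ] V)}
    (hf : Smooth f) (hg : Smooth g) :
    tderiv (fun L => ⁅f L, g L⁆) K X = ⁅tderiv f K X, g K⁆ + ⁅f K, tderiv g K X⁆ := by
  simp only [Ring.lie_def]
  rw [tderiv_sub hX (hf.mul hg) (hg.mul hf), tderiv_mul hX hf hg, tderiv_mul hX hg hf]
  abel

theorem tderiv_mem (hX : X ∈ tangent K) {f : TwistorSpace V → W} (hf : Smooth f)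
    {P : Submodule ℝ W} (hP : IsClosed (P : Set W)) (hfP : ∀ L, f L ∈ P) :
    tderiv f K X ∈ P := by
  obtain ⟨c, rfl, hc⟩ := (mem_tangent_iff K X).1 hX
  have hslope := hasDerivAt_iff_tendsto_slope.1 (hasDerivAt_comp_curve (hf _) hc)
  refine hP.mem_of_tendsto hslope (Filter.Eventually.of_forall fun t => ?_)
  exact P.smul_mem _ (P.sub_mem (hfP _) (hfP _))

end Derivatives

section Algebra

variable {V : Type*} [NormedAddCommGroup V] [InnerProductSpace ℝ V]

theorem mul_sandwich {M : Type*} [Semigroup M] {p q t : M} (h : p * t = t * q) (a : M) :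
    p * (t * a * t) = t * (q * a) * t := by
  rw [mul_assoc, ← mul_assoc, h]
  simp only [mul_assoc]

theorem sandwich_mul {M : Type*} [Semigroup M] {p q t : M} (h : t * p = q * t) (a : M) :
    t * a * t * p = t * (a * q) * t := by
  rw [mul_assoc _ t, h]
  simp only [mul_assoc]

theorem mem_skew_iff_star [CompleteSpace V] {A : V →L[ℝ] V} : A ∈ skew V ↔ star A = -A := by
  constructor
  · intro h
    refine ContinuousLinearMap.ext fun x => ext_inner_right ℝ fun y => ?_
    rw [ContinuousLinearMap.star_eq_adjoint, ContinuousLinearMap.adjoint_inner_left,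
      neg_apply, inner_neg_left, h x y, neg_neg]
  · intro h x y
    rw [← ContinuousLinearMap.adjoint_inner_right, ← ContinuousLinearMap.star_eq_adjoint, h,
      neg_apply, inner_neg_right]

theorem star_coe [CompleteSpace V] (K : TwistorSpace V) :
    star (K : V →L[ℝ] V) = -(K : V →L[ℝ] V) :=
  mem_skew_iff_star.1 (coe_mem_skew K)

theorem star_sandwich [CompleteSpace V] {t : V →L[ℝ] V} {ε : ℝ} (hε : ε * ε = 1)
    (ht : star t = ε • t) (A : V →L[ℝ] V) : star (t * A * t) = t * star A * t := by
  simp only [star_mul, ht, smul_mul_assoc, mul_smul_comm, smul_smul, hε, one_smul, mul_assoc]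

theorem sandwich_mem_skew [CompleteSpace V] {t A : V →L[ℝ] V} {ε : ℝ} (hε : ε * ε = 1)
    (ht : star t = ε • t) (hA : A ∈ skew V) : t * A * t ∈ skew V := by
  rw [mem_skew_iff_star] at hA ⊢
  rw [star_sandwich hε ht, hA, mul_neg, neg_mul]

theorem lie_mem_skew [CompleteSpace V] {A B : V →L[ℝ] V} (hA : A ∈ skew V) (hB : B ∈ skew V) :
    ⁅A, B⁆ ∈ skew V := by
  rw [mem_skew_iff_star] at hA hB ⊢
  rw [Ring.lie_def, star_sub, star_mul, star_mul, hA, hB, neg_mul_neg, neg_mul_neg, neg_sub]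

theorem mem_skewRel_self_iff {P A : V →L[ℝ] V} :
    A ∈ skewRel P P ↔ A ∈ skew V ∧ ⁅A, P⁆ = 0 := by
  rw [Ring.lie_def, sub_eq_zero]
  exact and_congr_right' eq_comm

theorem lie_mem_skewRel_self [CompleteSpace V] {P A B : V →L[ℝ] V} (hA : A ∈ skewRel P P)
    (hB : B ∈ skewRel P P) : ⁅A, B⁆ ∈ skewRel P P := by
  rw [mem_skewRel_self_iff] at hA hB ⊢
  exact ⟨lie_mem_skew hA.1 hB.1, by rw [lie_lie, hA.2, hB.2, lie_zero, lie_zero, sub_zero]⟩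

theorem lie_mem_tangent [CompleteSpace V] (K : TwistorSpace V) {C : V →L[ℝ] V}
    (hC : C ∈ skew V) : ⁅C, (K : V →L[ℝ] V)⁆ ∈ tangent K := by
  refine ⟨lie_mem_skew hC (coe_mem_skew K), ?_⟩
  rw [Ring.lie_def, mul_sub, sub_mul, mul_neg, mul_neg, ← mul_assoc (K : V →L[ℝ] V) K, mul_assoc C,
    coe_mul_self, mul_neg_one, neg_one_mul, mul_assoc]
  abel

end Algebra

section Generators

variable {V : Type*} [NormedAddCommGroup V] [InnerProductSpace ℝ V]

/-- The name of the section `-γ`. -/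
def Gen.neg : Gen → Gen
  | .J => .negJ
  | .negJ => .J
  | .phi => .negPhi
  | .negPhi => .phi

theorem Gen.eval_neg (J K : TwistorSpace V) (γ : Gen) : γ.neg.eval J K = -γ.eval J K := by
  cases γ <;> simp only [Gen.neg, Gen.eval, neg_neg]

theorem SType.tilde_neg (S : SType) (γ : Gen) : S.tilde γ.neg = (S.tilde γ).neg := by
  cases S <;> cases γ <;> rfl

theorem Gen.eval_mul_self (J K : TwistorSpace V) (γ : Gen) :
    γ.eval J K * γ.eval J K = -1 := by
  cases γ <;> simp only [Gen.eval, neg_mul_neg, coe_mul_self]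

theorem Gen.star_eval [CompleteSpace V] (J K : TwistorSpace V) (γ : Gen) :
    star (γ.eval J K) = -γ.eval J K := by
  cases γ <;> simp only [Gen.eval, star_neg, star_coe]

theorem Gen.smooth_eval (J : TwistorSpace V) : (γ : Gen) → Smooth (γ.eval J)
  | .J => Smooth.const _
  | .negJ => Smooth.const _
  | .phi => Smooth.coe
  | .negPhi => Smooth.coe.neg

theorem Gen.commute_eval {J K : TwistorSpace V} {Q : V →L[ℝ] V} (hJ : Commute Q J)
    (hK : Commute Q K) : (γ : Gen) → Commute Q (γ.eval J K)
  | .J => hJ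
  | .negJ => hJ.neg_right
  | .phi => hK
  | .negPhi => hK.neg_right

theorem SType.smooth_eval (J : TwistorSpace V) : (S : SType) → Smooth (S.eval J)
  | .one => Smooth.const _
  | .plus => (Smooth.const _).add Smooth.coe
  | .minus => (Smooth.const _).sub Smooth.coe
  | .comm => (Smooth.const _).lie Smooth.coe

theorem SType.commute_eval {J K : TwistorSpace V} {Q : V →L[ℝ] V} (hJ : Commute Q J)
    (hK : Commute Q K) : (S : SType) → Commute Q (S.eval J K)
  | .one => Commute.one_right Q
  | .plus => hJ.add_right hK
  | .minus => hJ.sub_right hK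
  | .comm => (hJ.mul_right hK).sub_right (hK.mul_right hJ)

theorem SType.exists_star_eval [CompleteSpace V] (J : TwistorSpace V) (S : SType) :
    ∃ ε : ℝ, ε * ε = 1 ∧ ∀ K, star (S.eval J K) = ε • S.eval J K := by
  cases S
  · exact ⟨1, one_mul 1, fun K => by simp only [SType.eval, star_one, one_smul]⟩
  all_goals
    refine ⟨-1, by norm_num, fun K => ?_⟩
    simp only [SType.eval, star_add, star_sub, star_mul, star_coe, neg_mul_neg, neg_one_smul]
    abel

/-- The derivative of `S` along a tangent vector, `P` standing for `J`: it is `0`, `X`, `-X`,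
`[P, X]` for `S` equal to `1`, `J + φ`, `J - φ`, `[J, φ]`. -/
noncomputable def SType.derivAlong (P : V →L[ℝ] V) : SType → (V →L[ℝ] V) →ₗ[ℝ] (V →L[ℝ] V)
  | .one => 0
  | .plus => LinearMap.id
  | .minus => -LinearMap.id
  | .comm => LieAlgebra.ad ℝ _ P

theorem SType.tderiv_eval [FiniteDimensional ℝ V] (J : TwistorSpace V) {K : TwistorSpace V}
    {X : V →L[ℝ] V} (hX : X ∈ tangent K) (S : SType) :
    tderiv (S.eval J) K X = S.derivAlong J X := by
  have hJ : Smooth fun _ : TwistorSpace V => (J : V →L[ℝ] V) := Smooth.const _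
  cases S
  · exact tderiv_const hX 1
  · refine (tderiv_add hX hJ Smooth.coe).trans ?_
    rw [tderiv_const hX, tderiv_coe hX, zero_add]
    rfl
  · refine (tderiv_sub hX hJ Smooth.coe).trans ?_
    rw [tderiv_const hX, tderiv_coe hX, zero_sub]
    rfl
  · refine (tderiv_lie hX hJ Smooth.coe).trans ?_
    rw [tderiv_const hX, tderiv_coe hX, zero_lie, zero_add]
    rfl

theorem SType.smooth_derivAlong {P X : TwistorSpace V → (V →L[ℝ] V)} (hP : Smooth P)
    (hX : Smooth X) : (S : SType) → Smooth fun K => S.derivAlong (P K) (X K)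
  | .one => Smooth.const 0
  | .plus => hX
  | .minus => hX.neg
  | .comm => hP.lie hX

end Generators

section Twisting

variable {V : Type*} [NormedAddCommGroup V] [InnerProductSpace ℝ V]

/-- The linear map `A ↦ [G A G, K]` on `End V`; its restriction to the fibre `E_K` is the anchor. -/
noncomputable def anchorMap (G K : V →L[ℝ] V) : (V →L[ℝ] V) →ₗ[ℝ] (V →L[ℝ] V) :=
  (LieAlgebra.ad ℝ (V →L[ℝ] V)).toLinearMap.flip K ∘ₗ LinearMap.mulLeftRight ℝ (G, G)

theorem anchorMap_apply (G K A : V →L[ℝ] V) : anchorMap G K A = ⁅G * A * G, K⁆ := rfl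

/-- The linear map `A ↦ dS_{[A, φ̃]}` at `K`, where `dS` is computed with `J̃` in place of `J`; it
describes `dS` along the vectors `[G A G, φ]`, see `IsTwisting.tderiv_eval`. -/
noncomputable def SType.quadFactor (S : SType) (J K : TwistorSpace V) :
    (V →L[ℝ] V) →ₗ[ℝ] (V →L[ℝ] V) :=
  S.derivAlong ((S.tilde .J).eval J K) ∘ₗ
    (LieAlgebra.ad ℝ (V →L[ℝ] V)).toLinearMap.flip ((S.tilde .phi).eval J K)

theorem SType.quadFactor_apply (S : SType) (J K : TwistorSpace V) (A : V →L[ℝ] V) :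
    S.quadFactor J K A =
      S.derivAlong ((S.tilde .J).eval J K) ⁅A, (S.tilde .phi).eval J K⁆ := rfl

theorem SType.smooth_quadFactor (S : SType) (J : TwistorSpace V)
    {A : TwistorSpace V → (V →L[ℝ] V)} (hA : Smooth A) :
    Smooth fun K => S.quadFactor J K (A K) :=
  S.smooth_derivAlong (Gen.smooth_eval J _) (hA.lie (Gen.smooth_eval J _))

/-- Smooth sections `G` of `𝔤𝔩(𝕍)` which are selfadjoint or skew-adjoint. -/
structure IsSymmOrSkew [CompleteSpace V] (G : TwistorSpace V → (V →L[ℝ] V)) : Prop where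
  smooth : Smooth G
  exists_sign : ∃ ε : ℝ, ε * ε = 1 ∧ ∀ K, star (G K) = ε • G K

/-- The sections `G` of `𝔤𝔩(𝕍)` which behave like `S`: they exchange `γ` and `γ̃`. -/
structure IsTwisting [CompleteSpace V] (S : SType) (J : TwistorSpace V)
    (G : TwistorSpace V → (V →L[ℝ] V)) : Prop extends IsSymmOrSkew G where
  eval_mul : ∀ γ K, Gen.eval J γ K * G K = G K * (S.tilde γ).eval J K
  mul_eval : ∀ γ K, G K * Gen.eval J γ K = (S.tilde γ).eval J K * G K

variable [CompleteSpace V] {S : SType} {J : TwistorSpace V}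

theorem SType.isTwisting_eval (S : SType) (J : TwistorSpace V) : IsTwisting S J (S.eval J) where
  smooth := S.smooth_eval J
  exists_sign := S.exists_star_eval J
  eval_mul γ K := eval_mul_eval J K S γ
  mul_eval γ K := eval_mul_eval' J K S γ

theorem isTwisting_mul {Q : TwistorSpace V → (V →L[ℝ] V)} (hQ : Smooth Q)
    (hQstar : ∀ K, star (Q K) = Q K) (hQJ : ∀ K, Commute (Q K) J) (hQK : ∀ K, Commute (Q K) K) :
    IsTwisting S J (fun K => Q K * S.eval J K) where
  smooth := hQ.mul (S.smooth_eval J)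
  exists_sign := by
    obtain ⟨ε, hε, hS⟩ := S.exists_star_eval J
    refine ⟨ε, hε, fun K => ?_⟩
    rw [star_mul, hS, hQstar, smul_mul_assoc, (SType.commute_eval (hQJ K) (hQK K) S).eq]
  eval_mul γ K := by
    rw [← mul_assoc, ← (Gen.commute_eval (hQJ K) (hQK K) γ).eq, mul_assoc, eval_mul_eval,
      mul_assoc]
  mul_eval γ K := by
    rw [mul_assoc, eval_mul_eval', ← mul_assoc,
      (Gen.commute_eval (hQJ K) (hQK K) (S.tilde γ)).eq, mul_assoc]

variable {G : TwistorSpace V → (V →L[ℝ] V)}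

theorem IsSymmOrSkew.star_mul_mul (hG : IsSymmOrSkew G) (K : TwistorSpace V) (A : V →L[ℝ] V) :
    star (G K * A * G K) = G K * star A * G K := by
  obtain ⟨ε, hε, hstar⟩ := hG.exists_sign
  exact star_sandwich hε (hstar K) A

theorem IsSymmOrSkew.mul_mul_mem_skew (hG : IsSymmOrSkew G) (K : TwistorSpace V)
    {A : V →L[ℝ] V} (hA : A ∈ skew V) : G K * A * G K ∈ skew V := by
  obtain ⟨ε, hε, hstar⟩ := hG.exists_sign
  exact sandwich_mem_skew hε (hstar K) hA

theorem IsSymmOrSkew.anchorMap_mem_tangent (hG : IsSymmOrSkew G) (K : TwistorSpace V)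
    {A : V →L[ℝ] V} (hA : A ∈ skew V) : anchorMap (G K) K A ∈ tangent K :=
  lie_mem_tangent K (hG.mul_mul_mem_skew K hA)

theorem IsSymmOrSkew.smooth_mul_mul (hG : IsSymmOrSkew G) {A : TwistorSpace V → (V →L[ℝ] V)}
    (hA : Smooth A) : Smooth fun K => G K * A K * G K :=
  (hG.smooth.mul hA).mul hG.smooth

theorem IsSymmOrSkew.smooth_anchorMap (hG : IsSymmOrSkew G) {A : TwistorSpace V → (V →L[ℝ] V)}
    (hA : Smooth A) : Smooth fun K => anchorMap (G K) K (A K) :=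
  (hG.smooth_mul_mul hA).lie Smooth.coe

namespace IsTwisting

theorem eval_mul_mul_mul (hG : IsTwisting S J G) (γ : Gen) (K : TwistorSpace V)
    (A : V →L[ℝ] V) :
    γ.eval J K * (G K * A * G K) = G K * ((S.tilde γ).eval J K * A) * G K :=
  mul_sandwich (hG.eval_mul γ K) A

theorem mul_mul_mul_eval (hG : IsTwisting S J G) (γ : Gen) (K : TwistorSpace V)
    (A : V →L[ℝ] V) :
    G K * A * G K * γ.eval J K = G K * (A * (S.tilde γ).eval J K) * G K :=
  sandwich_mul (hG.mul_eval γ K) A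

theorem mul_mul_lie_eval (hG : IsTwisting S J G) (γ : Gen) (K : TwistorSpace V)
    (A : V →L[ℝ] V) :
    ⁅G K * A * G K, γ.eval J K⁆ = G K * ⁅A, (S.tilde γ).eval J K⁆ * G K := by
  rw [Ring.lie_def, Ring.lie_def, hG.eval_mul_mul_mul, hG.mul_mul_mul_eval, mul_sub, sub_mul]

theorem derivAlong_mul_mul (hG : IsTwisting S J G) (K : TwistorSpace V) (M : V →L[ℝ] V) :
    S.derivAlong J (G K * M * G K) =
      G K * S.derivAlong ((S.tilde .J).eval J K) M * G K := by
  cases S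
  · simp only [SType.derivAlong, LinearMap.zero_apply, mul_zero, zero_mul]
  · rfl
  · simp only [SType.derivAlong, LinearMap.neg_apply, LinearMap.id_apply, mul_neg, neg_mul]
  · simp only [SType.derivAlong, LieAlgebra.ad_apply]
    rw [← lie_skew, ← lie_skew _ M, mul_neg, neg_mul]
    exact congrArg Neg.neg (hG.mul_mul_lie_eval .J K M)

theorem anchorMap_eq (hG : IsTwisting S J G) (K : TwistorSpace V) (A : V →L[ℝ] V) :
    anchorMap (G K) K A = G K * ⁅A, (S.tilde .phi).eval J K⁆ * G K :=
  hG.mul_mul_lie_eval .phi K A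

end IsTwisting

theorem IsTwisting.tderiv_eval [FiniteDimensional ℝ V] (hG : IsTwisting S J G)
    (K : TwistorSpace V) {A : V →L[ℝ] V} (hA : A ∈ skew V) :
    tderiv (S.eval J) K (anchorMap (G K) K A) = G K * S.quadFactor J K A * G K := by
  rw [S.tderiv_eval J (hG.anchorMap_mem_tangent K hA), hG.anchorMap_eq, hG.derivAlong_mul_mul,
    SType.quadFactor_apply]

end Twisting

section Subbundle

theorem bijective_mulLeftRight_of_isUnit {R A : Type*} [CommSemiring R] [Semiring A] [Algebra R A]
    {a : A} (ha : IsUnit a) : Function.Bijective (LinearMap.mulLeftRight R (a, a)) := by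
  obtain ⟨u, rfl⟩ := ha
  refine Function.bijective_iff_has_inverse.2 ⟨fun b => ↑u⁻¹ * b * ↑u⁻¹, fun b => ?_, fun b => ?_⟩
  all_goals simp [mul_assoc]

variable {V : Type*} [NormedAddCommGroup V] [InnerProductSpace ℝ V]

theorem sandwich_mem_skewRel_iff [CompleteSpace V] {t p q p' q' A : V →L[ℝ] V} {ε : ℝ}
    (ht : IsUnit t) (hε : ε * ε = 1) (hstar : star t = ε • t) (hp : p' * t = t * p)
    (hq : t * q' = q * t) : t * A * t ∈ skewRel p' q' ↔ A ∈ skewRel p q := by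
  refine and_congr ?_ ?_
  · rw [mem_skew_iff_star, mem_skew_iff_star, star_sandwich hε hstar, ← neg_mul, ← mul_neg,
      ht.mul_left_inj, ht.mul_right_inj]
  · rw [mul_sandwich hp, sandwich_mul hq, ht.mul_left_inj, ht.mul_right_inj]

variable [FiniteDimensional ℝ V]

/-- If `A ↦ T_{KL} A T_{KL}` carries `E_K` to `E_L`, then it carries a basis of `E_K` to a smooth
frame of `E` around `K`. -/
theorem isSubbundle_of_sandwich {E : TwistorSpace V → Submodule ℝ (V →L[ℝ] V)}
    {T : TwistorSpace V → TwistorSpace V → (V →L[ℝ] V)} (hT : ∀ K, Smooth (T K))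
    (hunit : ∀ K, IsUnit (T K K))
    (hmem : ∀ K L A, IsUnit (T K L) → (T K L * A * T K L ∈ E L ↔ A ∈ E K)) :
    IsSubbundle E := by
  intro K
  let b := Module.finBasis ℝ (E K)
  refine ⟨{L | IsUnit (T K L)}, _, fun i L => T K L * (b i : V →L[ℝ] V) * T K L,
    Units.isOpen.preimage (hT K).continuous, hunit K,
    fun i L _ => ((hT K).mul (Smooth.const _)).mul (hT K) L, fun L hL => ?_⟩
  have hbij := bijective_mulLeftRight_of_isUnit (R := ℝ) hL
  set Φ := LinearMap.mulLeftRight ℝ (T K L, T K L)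
  have hE : E K = (E L).comap Φ := Submodule.ext fun A => (hmem K L A hL).symm
  refine ⟨(b.linearIndependent.map' (E K).subtype (E K).ker_subtype).map' Φ
    (LinearMap.ker_eq_bot.2 hbij.injective), ?_⟩
  calc Submodule.span ℝ (Set.range (Φ ∘ (E K).subtype ∘ b))
      = (E K).map Φ := by
        rw [Set.range_comp, Set.range_comp, Submodule.span_image, Submodule.span_image, b.span_eq,
          Submodule.map_subtype_top]
    _ = E L := by rw [hE, Submodule.map_comap_eq_of_surjective hbij.surjective]

theorem isSubbundle_const (P : Submodule ℝ (V →L[ℝ] V)) :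
    IsSubbundle (fun _ : TwistorSpace V => P) :=
  isSubbundle_of_sandwich (T := fun _ _ => 1) (fun _ => Smooth.const 1) (fun _ => isUnit_one)
    fun _ _ _ _ => by rw [one_mul, mul_one]

theorem isSubbundle_skewRel_smul {g : TwistorSpace V → (V →L[ℝ] V)} (hg : Smooth g)
    (hsq : ∀ K, g K * g K = -1) (hskew : ∀ K, g K ∈ skew V) (s : ℝ) :
    IsSubbundle (fun K => skewRel (g K) (s • g K)) := by
  refine isSubbundle_of_sandwich (T := fun K L => g K + g L)
    (fun K => (Smooth.const _).add hg) (fun K => ?_) fun K L A hKL => ?_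
  · have hunit : IsUnit (g K) :=
      ⟨⟨g K, -g K, by rw [mul_neg, hsq, neg_neg], by rw [neg_mul, hsq, neg_neg]⟩, rfl⟩
    rw [← two_smul ℝ]
    exact hunit.smul (Units.mk0 (2 : ℝ) two_ne_zero)
  · have hstar : star (g K + g L) = (-1 : ℝ) • (g K + g L) := by
      rw [neg_one_smul, ← mem_skew_iff_star]
      exact add_mem (hskew K) (hskew L)
    have hleft : g L * (g K + g L) = (g K + g L) * g K := by
      rw [mul_add, add_mul, hsq, hsq, add_comm]
    have hright : (g K + g L) * g L = g K * (g K + g L) := by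
      rw [mul_add, add_mul, hsq, hsq, add_comm]
    exact sandwich_mem_skewRel_iff hKL (by norm_num) hstar hleft
      (by rw [mul_smul_comm, smul_mul_assoc, hright])

end Subbundle

section Bundles

variable {V : Type*} [NormedAddCommGroup V] [InnerProductSpace ℝ V]

/-- The bundles `𝔬(𝕍, g)` and `{A | γ A = A δ}` with `δ = ±γ`. -/
def BType.IsSigned : BType → Prop
  | .all => True
  | .rel γ δ => δ = γ ∨ δ = γ.neg

theorem BType.IsSigned.twist (S : SType) : {E : BType} → E.IsSigned → (E.twist S).IsSigned
  | .all, _ => trivial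
  | .rel _ _, .inl h => .inl (congrArg S.tilde h)
  | .rel γ _, .inr h => .inr ((congrArg S.tilde h).trans (S.tilde_neg γ))

theorem BType.IsSigned.exists_eval_eq_smul {γ δ : Gen} (h : (BType.rel γ δ).IsSigned)
    (J : TwistorSpace V) : ∃ s : ℝ, ∀ K, δ.eval J K = s • γ.eval J K := by
  rcases h with rfl | rfl
  · exact ⟨1, fun K => (one_smul ℝ _).symm⟩
  · exact ⟨-1, fun K => by rw [Gen.eval_neg, neg_one_smul]⟩

theorem BType.fiber_le_skew (J K : TwistorSpace V) : (T : BType) → T.fiber J K ≤ skew V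
  | .all => le_rfl
  | .rel _ _ => fun _ h => h.1

theorem BType.IsSigned.isSubbundle_fiber [FiniteDimensional ℝ V] {T : BType} (hT : T.IsSigned)
    (J : TwistorSpace V) : IsSubbundle (T.fiber J) := by
  cases T with
  | all => exact isSubbundle_const (skew V)
  | rel γ δ =>
    obtain ⟨s, hs⟩ := hT.exists_eval_eq_smul J
    have hfiber : BType.fiber J (.rel γ δ) = fun K => skewRel (γ.eval J K) (s • γ.eval J K) :=
      funext fun K => congrArg (skewRel (γ.eval J K)) (hs K)
    rw [hfiber]
    exact isSubbundle_skewRel_smul (γ.smooth_eval J) (fun K => γ.eval_mul_self J K)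
      (fun K => mem_skew_iff_star.2 (γ.star_eval J K)) s

theorem IsTwisting.mul_mul_mem_fiber [CompleteSpace V] {S : SType} {J : TwistorSpace V}
    {G : TwistorSpace V → (V →L[ℝ] V)} (hG : IsTwisting S J G) {E : BType} (K : TwistorSpace V)
    {A : V →L[ℝ] V} (hA : A ∈ (E.twist S).fiber J K) : G K * A * G K ∈ E.fiber J K := by
  cases E with
  | all => exact hG.mul_mul_mem_skew K hA
  | rel γ δ =>
    refine ⟨hG.mul_mul_mem_skew K hA.1, ?_⟩
    rw [hG.eval_mul_mul_mul, hG.mul_mul_mul_eval, hA.2]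

/-- The skew part `(C - C*) / 2`. -/
noncomputable def skewPart [CompleteSpace V] : (V →L[ℝ] V) →ₗ[ℝ] (V →L[ℝ] V) :=
  (2 : ℝ)⁻¹ • (LinearMap.id - (starL' ℝ : (V →L[ℝ] V) ≃L[ℝ] (V →L[ℝ] V)).toLinearMap)

theorem skewPart_apply [CompleteSpace V] (C : V →L[ℝ] V) :
    skewPart C = (2 : ℝ)⁻¹ • (C - star C) := rfl

theorem skewPart_mem_skew [CompleteSpace V] (C : V →L[ℝ] V) : skewPart C ∈ skew V := by
  rw [mem_skew_iff_star, skewPart_apply, star_smul, star_sub, star_star, star_trivial, ← smul_neg,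
    neg_sub]

theorem skewPart_eq_self [CompleteSpace V] {C : V →L[ℝ] V} (hC : C ∈ skew V) :
    skewPart C = C := by
  rw [skewPart_apply, mem_skew_iff_star.1 hC, sub_neg_eq_add, ← two_smul ℝ,
    inv_smul_smul₀ two_ne_zero]

/-- A projection of `End V` onto the fibre at `K` of the bundle named by an element of `BType`; for
`{A | γ A = A δ}` with `δ = ±γ` it averages the skew part `C` and `γ⁻¹ C δ = -γ C δ`. -/
noncomputable def BType.proj [CompleteSpace V] (J K : TwistorSpace V) :
    BType → (V →L[ℝ] V) →ₗ[ℝ] (V →L[ℝ] V)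
  | .all => skewPart
  | .rel γ δ =>
    (2 : ℝ)⁻¹ • (LinearMap.id - LinearMap.mulLeftRight ℝ (γ.eval J K, δ.eval J K)) ∘ₗ skewPart

namespace BType

variable [CompleteSpace V]

theorem proj_rel_apply (J K : TwistorSpace V) (γ δ : Gen) (C : V →L[ℝ] V) :
    (BType.rel γ δ).proj J K C =
      (2 : ℝ)⁻¹ • (skewPart C - γ.eval J K * skewPart C * δ.eval J K) := rfl

theorem smooth_proj (T : BType) (J : TwistorSpace V) {C : TwistorSpace V → (V →L[ℝ] V)}
    (hC : Smooth C) : Smooth fun K => T.proj J K (C K) := by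
  have hskew : Smooth fun K => skewPart (C K) := (hC.sub hC.star).const_smul _
  cases T with
  | all => exact hskew
  | rel γ δ =>
    exact (hskew.sub (((γ.smooth_eval J).mul hskew).mul (δ.smooth_eval J))).const_smul _

theorem IsSigned.proj_mem {T : BType} (hT : T.IsSigned) (J K : TwistorSpace V)
    (C : V →L[ℝ] V) : T.proj J K C ∈ T.fiber J K := by
  cases T with
  | all => exact skewPart_mem_skew C
  | rel γ δ =>
    have hγ : γ.eval J K * γ.eval J K = -1 := γ.eval_mul_self J K
    have hδ : δ.eval J K * δ.eval J K = -1 := δ.eval_mul_self J K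
    rw [proj_rel_apply]
    refine Submodule.smul_mem _ _ ⟨sub_mem (skewPart_mem_skew C) ?_, ?_⟩
    · obtain ⟨s, hs⟩ := hT.exists_eval_eq_smul J
      rw [hs, mul_smul_comm]
      refine Submodule.smul_mem _ _ (sandwich_mem_skew (ε := -1) (by norm_num) ?_
        (skewPart_mem_skew C))
      rw [γ.star_eval, neg_one_smul]
    · simp only [mul_sub, sub_mul, ← mul_assoc, hγ]
      simp only [mul_assoc, hδ, sub_neg_eq_add, neg_mul, mul_neg, one_mul, mul_one]
      exact add_comm _ _

theorem proj_eq_self (T : BType) (J K : TwistorSpace V) {C : V →L[ℝ] V}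
    (hC : C ∈ T.fiber J K) : T.proj J K C = C := by
  cases T with
  | all => exact skewPart_eq_self hC
  | rel γ δ =>
    rw [proj_rel_apply, skewPart_eq_self hC.1, hC.2, mul_assoc, δ.eval_mul_self, mul_neg_one,
      sub_neg_eq_add, ← two_smul ℝ, inv_smul_smul₀ two_ne_zero]

end BType

theorem IsSymmOrSkew.mul_skewPart_mul [CompleteSpace V] {G : TwistorSpace V → (V →L[ℝ] V)}
    (hG : IsSymmOrSkew G) (K : TwistorSpace V) (C : V →L[ℝ] V) :
    G K * skewPart C * G K = skewPart (G K * C * G K) := by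
  simp only [skewPart_apply, hG.star_mul_mul, mul_smul_comm, smul_mul_assoc, mul_sub, sub_mul]

theorem IsTwisting.mul_proj_mul [CompleteSpace V] {S : SType} {J : TwistorSpace V}
    {G : TwistorSpace V → (V →L[ℝ] V)} (hG : IsTwisting S J G) (E : BType) (K : TwistorSpace V)
    (C : V →L[ℝ] V) :
    G K * (E.twist S).proj J K C * G K = E.proj J K (G K * C * G K) := by
  cases E with
  | all => exact hG.mul_skewPart_mul K C
  | rel γ δ =>
    rw [BType.twist, BType.proj_rel_apply, BType.proj_rel_apply, ← hG.mul_skewPart_mul,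
      hG.eval_mul_mul_mul, hG.mul_mul_mul_eval, mul_smul_comm, smul_mul_assoc, mul_sub, sub_mul]

end Bundles

section LiftBracket

variable {V : Type*} [NormedAddCommGroup V] [InnerProductSpace ℝ V]

/-- The bracket of `𝔬(V, g)`-valued maps which `a ↦ [a, φ]` carries to the Lie bracket of vector
fields, see `lieBracket_lie_coe`. -/
noncomputable def liftBracket (a b : TwistorSpace V → (V →L[ℝ] V)) (K : TwistorSpace V) :
    V →L[ℝ] V :=
  tderiv b K ⁅a K, (K : V →L[ℝ] V)⁆ - tderiv a K ⁅b K, (K : V →L[ℝ] V)⁆ - ⁅a K, b K⁆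

/-- The vector fields `[a, φ]`, `a ∈ Γ(E)`, are closed under the Lie bracket: the projection of
`liftBracket a b` to `E` represents the same vector field. -/
def BType.IsLiftClosed [CompleteSpace V] (E : BType) (J : TwistorSpace V) : Prop :=
  ∀ (a b : Sections (E.fiber J)) (K : TwistorSpace V),
    ⁅E.proj J K (liftBracket a.1 b.1 K), (K : V →L[ℝ] V)⁆ =
      ⁅liftBracket a.1 b.1 K, (K : V →L[ℝ] V)⁆

variable [FiniteDimensional ℝ V]

theorem lieBracket_lie_coe {a b : TwistorSpace V → (V →L[ℝ] V)} (ha : Smooth a) (hb : Smooth b)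
    (K : TwistorSpace V) (hat : ⁅a K, (K : V →L[ℝ] V)⁆ ∈ tangent K)
    (hbt : ⁅b K, (K : V →L[ℝ] V)⁆ ∈ tangent K) :
    lieBracket (fun L => ⁅a L, (L : V →L[ℝ] V)⁆) (fun L => ⁅b L, (L : V →L[ℝ] V)⁆) K =
      ⁅liftBracket a b K, (K : V →L[ℝ] V)⁆ := by
  rw [lieBracket, tderiv_lie hat hb Smooth.coe, tderiv_lie hbt ha Smooth.coe, tderiv_coe hat,
    tderiv_coe hbt, liftBracket, sub_lie, sub_lie, lie_lie]
  abel

theorem liftBracket_mem_skew {a b : TwistorSpace V → (V →L[ℝ] V)} (ha : Smooth a)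
    (hb : Smooth b) (has : ∀ K, a K ∈ skew V) (hbs : ∀ K, b K ∈ skew V) (K : TwistorSpace V) :
    liftBracket a b K ∈ skew V := by
  have hclosed : IsClosed (skew V : Set (V →L[ℝ] V)) := Submodule.closed_of_finiteDimensional _
  exact sub_mem (sub_mem (tderiv_mem (lie_mem_tangent K (has K)) hb hclosed hbs)
    (tderiv_mem (lie_mem_tangent K (hbs K)) ha hclosed has)) (lie_mem_skew (has K) (hbs K))

namespace BType

theorem isLiftClosed_of_liftBracket_mem {E : BType} {J : TwistorSpace V}
    (h : ∀ (a b : Sections (E.fiber J)) K, liftBracket a.1 b.1 K ∈ E.fiber J K) :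
    E.IsLiftClosed J := fun a b K => by rw [E.proj_eq_self J K (h a b K)]

theorem isLiftClosed_all (J : TwistorSpace V) : BType.all.IsLiftClosed J :=
  isLiftClosed_of_liftBracket_mem fun a b => liftBracket_mem_skew a.2.1 b.2.1 a.2.2 b.2.2

theorem isLiftClosed_oPhi (J : TwistorSpace V) : BType.oPhi.IsLiftClosed J := fun a b K => by
  have hskew := liftBracket_mem_skew a.2.1 b.2.1 (fun L => (a.2.2 L).1) (fun L => (b.2.2 L).1) K
  set c := liftBracket a.1 b.1 K
  have hconj : ⁅(K : V →L[ℝ] V) * c * K, (K : V →L[ℝ] V)⁆ = ⁅c, (K : V →L[ℝ] V)⁆ := by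
    rw [Ring.lie_def, Ring.lie_def, mul_assoc, coe_mul_self, ← mul_assoc, ← mul_assoc,
      coe_mul_self, mul_neg_one, neg_one_mul, neg_mul, sub_neg_eq_add, neg_add_eq_sub]
  rw [oPhi, proj_rel_apply, skewPart_eq_self hskew]
  simp only [Gen.eval, mul_neg, sub_neg_eq_add]
  rw [smul_lie, add_lie, hconj, ← two_smul ℝ, inv_smul_smul₀ two_ne_zero]

theorem isLiftClosed_uJ (J : TwistorSpace V) : BType.uJ.IsLiftClosed J :=
  isLiftClosed_of_liftBracket_mem fun a b K => by
    have hclosed : IsClosed (skewRel (J : V →L[ℝ] V) J : Set (V →L[ℝ] V)) :=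
      Submodule.closed_of_finiteDimensional _
    exact sub_mem (sub_mem
      (tderiv_mem (lie_mem_tangent K (a.2.2 K).1) b.2.1 hclosed b.2.2)
      (tderiv_mem (lie_mem_tangent K (b.2.2 K).1) a.2.1 hclosed a.2.2))
      (lie_mem_skewRel_self (a.2.2 K) (b.2.2 K))

theorem isLiftClosed_uPhi (J : TwistorSpace V) : BType.uPhi.IsLiftClosed J :=
  isLiftClosed_of_liftBracket_mem fun a b K => by
    have ha : ⁅a.1 K, (K : V →L[ℝ] V)⁆ = 0 := (mem_skewRel_self_iff.1 (a.2.2 K)).2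
    have hb : ⁅b.1 K, (K : V →L[ℝ] V)⁆ = 0 := (mem_skewRel_self_iff.1 (b.2.2 K)).2
    have hlift : liftBracket a.1 b.1 K = -⁅a.1 K, b.1 K⁆ := by
      simp only [liftBracket, ha, hb, tderiv, map_zero, sub_self, zero_sub]
    rw [hlift]
    exact neg_mem (lie_mem_skewRel_self (a.2.2 K) (b.2.2 K))

end BType

end LiftBracket

section TwistedBracket

variable {V : Type*} [NormedAddCommGroup V] [InnerProductSpace ℝ V]

section HalfBracket

/-- The non-skew bracket `dB_{[F A F, φ]} + Λ_A B + B Λ_A* - A F² B`, where `Λ_A` is meant to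
satisfy `dF_{[F A F, φ]} = F Λ_A`; see `mul_halfBracket_mul` for its characterisation. -/
noncomputable def halfBracket [CompleteSpace V] (F : TwistorSpace V → (V →L[ℝ] V))
    (Λ : TwistorSpace V → (V →L[ℝ] V) →ₗ[ℝ] (V →L[ℝ] V)) (A B : TwistorSpace V → (V →L[ℝ] V))
    (K : TwistorSpace V) : V →L[ℝ] V :=
  tderiv B K (anchorMap (F K) K (A K)) + Λ K (A K) * B K + B K * star (Λ K (A K)) -
    A K * (F K * F K) * B K

variable {F A A' B B' : TwistorSpace V → (V →L[ℝ] V)}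
variable {Λ : TwistorSpace V → (V →L[ℝ] V) →ₗ[ℝ] (V →L[ℝ] V)}

theorem halfBracket_add_left [CompleteSpace V] (K : TwistorSpace V) :
    halfBracket F Λ (A + A') B K = halfBracket F Λ A B K + halfBracket F Λ A' B K := by
  simp only [halfBracket, Pi.add_apply, map_add, star_add, add_mul, mul_add, tderiv]
  abel

theorem halfBracket_smul_left [CompleteSpace V] (f : TwistorSpace V → ℝ) (K : TwistorSpace V) :
    halfBracket F Λ (fun L => f L • A L) B K = f K • halfBracket F Λ A B K := by
  simp only [halfBracket, map_smul, star_smul, smul_mul_assoc, mul_smul_comm, tderiv, smul_add,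
    smul_sub, star_trivial]

variable [FiniteDimensional ℝ V]

theorem halfBracket_add_right (hB : Smooth B) (hB' : Smooth B') {K : TwistorSpace V}
    (hA : anchorMap (F K) K (A K) ∈ tangent K) :
    halfBracket F Λ A (B + B') K = halfBracket F Λ A B K + halfBracket F Λ A B' K := by
  have h : tderiv (B + B') K _ = _ := tderiv_add hA hB hB'
  simp only [halfBracket, h, Pi.add_apply, add_mul, mul_add]
  abel

theorem halfBracket_smul_right {f : TwistorSpace V → ℝ} (hf : Smooth f) (hB : Smooth B)
    {K : TwistorSpace V} (hA : anchorMap (F K) K (A K) ∈ tangent K) :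
    halfBracket F Λ A (fun L => f L • B L) K =
      f K • halfBracket F Λ A B K + tderiv f K (anchorMap (F K) K (A K)) • B K := by
  simp only [halfBracket, tderiv_smul hA hf hB, smul_mul_assoc, mul_smul_comm, smul_add, smul_sub]
  abel

theorem IsSymmOrSkew.tderiv_eq_star_mul (hF : IsSymmOrSkew F) {K : TwistorSpace V}
    {X M : V →L[ℝ] V} (hX : X ∈ tangent K) (h : tderiv F K X = F K * M) :
    tderiv F K X = star M * F K := by
  obtain ⟨ε, hε, hstar⟩ := hF.exists_sign
  have hderiv : star (tderiv F K X) = ε • tderiv F K X := by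
    rw [← tderiv_star hX hF.smooth, funext hstar, tderiv_smul hX (Smooth.const ε) hF.smooth,
      tderiv_const hX, zero_smul, add_zero]
  calc tderiv F K X = ε • star (tderiv F K X) := by rw [hderiv, smul_smul, hε, one_smul]
    _ = star M * F K := by
      rw [h, star_mul, hstar, mul_smul_comm, smul_smul, hε, one_smul]

theorem IsSymmOrSkew.mul_halfBracket_mul (hF : IsSymmOrSkew F) (hB : Smooth B)
    {K : TwistorSpace V} (hA : anchorMap (F K) K (A K) ∈ tangent K)
    (hd : tderiv F K (anchorMap (F K) K (A K)) = F K * Λ K (A K)) :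
    F K * halfBracket F Λ A B K * F K =
      tderiv (fun L => F L * B L * F L) K (anchorMap (F K) K (A K)) -
        (F K * A K * F K) * (F K * B K * F K) := by
  rw [tderiv_mul hA (hF.smooth.mul hB) hF.smooth, tderiv_mul hA hF.smooth hB]
  nth_rewrite 2 [hF.tderiv_eq_star_mul hA hd]
  rw [hd]
  simp only [halfBracket, mul_add, add_mul, mul_sub, sub_mul, mul_assoc]
  abel

end HalfBracket

variable [FiniteDimensional ℝ V]

/-- `Λ` is a smooth linear family with `dF_{[F A F, φ]} = F Λ_A` for all `A ∈ Γ(E)`. -/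
structure IsLeftFactor (E : TwistorSpace V → Submodule ℝ (V →L[ℝ] V))
    (F : TwistorSpace V → (V →L[ℝ] V))
    (Λ : TwistorSpace V → (V →L[ℝ] V) →ₗ[ℝ] (V →L[ℝ] V)) : Prop where
  smooth : ∀ A : Sections E, Smooth fun K => Λ K (A.1 K)
  tderiv_eq : ∀ (A : Sections E) K,
    tderiv F K (anchorMap (F K) K (A.1 K)) = F K * Λ K (A.1 K)

/-- The projection of `End V`-valued maps to sections of a bundle. -/
noncomputable def BType.IsSigned.projₗ {T : BType} (hT : T.IsSigned) (J : TwistorSpace V) :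
    Sections (fun _ : TwistorSpace V => (⊤ : Submodule ℝ (V →L[ℝ] V))) →ₗ[ℝ]
      Sections (T.fiber J) where
  toFun C := ⟨fun K => T.proj J K (C.1 K), T.smooth_proj J C.2.1, fun K => hT.proj_mem J K _⟩
  map_add' _ _ := Subtype.ext <| funext fun _ => map_add _ _ _
  map_smul' r C := Subtype.ext <| funext fun K => map_smul (T.proj J K) r (C.1 K)

namespace IsLeftFactor

variable {E : TwistorSpace V → Submodule ℝ (V →L[ℝ] V)} {F : TwistorSpace V → (V →L[ℝ] V)}
variable {Λ : TwistorSpace V → (V →L[ℝ] V) →ₗ[ℝ] (V →L[ℝ] V)}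

theorem smooth_halfBracket (hΛ : IsLeftFactor E F Λ) (hF : IsSymmOrSkew F)
    (hE : ∀ K, E K ≤ skew V) (A B : Sections E) : Smooth (halfBracket F Λ A.1 B.1) := by
  have hderiv : Smooth fun K => tderiv B.1 K (anchorMap (F K) K (A.1 K)) :=
    B.2.1.tderiv (hF.smooth_anchorMap A.2.1) fun K => hF.anchorMap_mem_tangent K (hE K (A.2.2 K))
  exact ((hderiv.add ((hΛ.smooth A).mul B.2.1)).add (B.2.1.mul (hΛ.smooth A).star)).sub
    ((A.2.1.mul (hF.smooth.mul hF.smooth)).mul B.2.1)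

/-- `halfBracket` as a bilinear map on `Γ(E)`. -/
noncomputable def halfBracketₗ (hΛ : IsLeftFactor E F Λ) (hF : IsSymmOrSkew F)
    (hE : ∀ K, E K ≤ skew V) :
    Sections E →ₗ[ℝ] Sections E →ₗ[ℝ]
      Sections (fun _ : TwistorSpace V => (⊤ : Submodule ℝ (V →L[ℝ] V))) :=
  have htangent (A : Sections E) K : anchorMap (F K) K (A.1 K) ∈ tangent K :=
    hF.anchorMap_mem_tangent K (hE K (A.2.2 K))
  LinearMap.mk₂ ℝ
    (fun A B => ⟨halfBracket F Λ A.1 B.1, hΛ.smooth_halfBracket hF hE A B, fun _ => trivial⟩)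
    (fun _ _ _ => Subtype.ext <| funext halfBracket_add_left)
    (fun r _ _ => Subtype.ext <| funext (halfBracket_smul_left fun _ => r))
    (fun A B B' => Subtype.ext <| funext fun K =>
      halfBracket_add_right B.2.1 B'.2.1 (htangent A K))
    (fun r A B => Subtype.ext <| funext fun K =>
      (halfBracket_smul_right (Smooth.const r) B.2.1 (htangent A K)).trans <| by
        rw [tderiv_const (htangent A K), zero_smul, add_zero]
        rfl)

end IsLeftFactor

/-- The bracket `[A, B]_F` on `Γ(T)`: the projection to `T` of the skew-symmetrisation of
`halfBracket`. -/
noncomputable def twistedBracket {T : BType} (hT : T.IsSigned) {J : TwistorSpace V}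
    {F : TwistorSpace V → (V →L[ℝ] V)} (hF : IsSymmOrSkew F)
    {Λ : TwistorSpace V → (V →L[ℝ] V) →ₗ[ℝ] (V →L[ℝ] V)} (hΛ : IsLeftFactor (T.fiber J) F Λ) :
    Sections (T.fiber J) →ₗ[ℝ] Sections (T.fiber J) →ₗ[ℝ] Sections (T.fiber J) :=
  let half := hΛ.halfBracketₗ hF fun K => T.fiber_le_skew J K
  half.compr₂ (hT.projₗ J) + half.flip.compr₂ (-hT.projₗ J)

section

variable {T : BType} (hT : T.IsSigned) {J : TwistorSpace V} {F : TwistorSpace V → (V →L[ℝ] V)}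
variable {Λ : TwistorSpace V → (V →L[ℝ] V) →ₗ[ℝ] (V →L[ℝ] V)}

theorem twistedBracket_apply (hF : IsSymmOrSkew F) (hΛ : IsLeftFactor (T.fiber J) F Λ)
    (A B : Sections (T.fiber J)) (K : TwistorSpace V) :
    (twistedBracket hT hF hΛ A B).1 K =
      T.proj J K (halfBracket F Λ A.1 B.1 K - halfBracket F Λ B.1 A.1 K) := by
  rw [map_sub, sub_eq_add_neg]
  rfl

theorem twistedBracket_skew (hF : IsSymmOrSkew F) (hΛ : IsLeftFactor (T.fiber J) F Λ)
    (A B : Sections (T.fiber J)) :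
    twistedBracket hT hF hΛ A B = -twistedBracket hT hF hΛ B A := by
  refine Subtype.ext <| funext fun K => ?_
  change _ = -(twistedBracket hT hF hΛ B A).1 K
  rw [twistedBracket_apply, twistedBracket_apply, ← map_neg, neg_sub]

theorem twistedBracket_fsmul (hF : IsSymmOrSkew F) (hΛ : IsLeftFactor (T.fiber J) F Λ)
    (A B : Sections (T.fiber J)) {f : TwistorSpace V → ℝ} (hf : Smooth f) (K : TwistorSpace V) :
    (twistedBracket hT hF hΛ A (fsmul f hf B)).1 K =
      f K • (twistedBracket hT hF hΛ A B).1 K +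
        tderiv f K (anchorMap (F K) K (A.1 K)) • B.1 K := by
  have htangent := hF.anchorMap_mem_tangent K (T.fiber_le_skew J K (A.2.2 K))
  have hright : halfBracket F Λ A.1 (fsmul f hf B).1 K = _ :=
    halfBracket_smul_right hf B.2.1 htangent
  have hleft : halfBracket F Λ (fsmul f hf B).1 A.1 K = _ := halfBracket_smul_left f K
  rw [twistedBracket_apply, twistedBracket_apply, hright, hleft, add_sub_right_comm, ← smul_sub,
    map_add, map_smul, map_smul, T.proj_eq_self J K (B.2.2 K)]

end

namespace IsTwisting

variable {S : SType} {E : BType} {J : TwistorSpace V} {F : TwistorSpace V → (V →L[ℝ] V)}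
variable {Λ : TwistorSpace V → (V →L[ℝ] V) →ₗ[ℝ] (V →L[ℝ] V)}

theorem mul_twistedBracket_mul (hF : IsTwisting S J F) (hT : (E.twist S).IsSigned)
    (hΛ : IsLeftFactor ((E.twist S).fiber J) F Λ) (A B : Sections ((E.twist S).fiber J))
    (K : TwistorSpace V) :
    F K * (twistedBracket hT hF.toIsSymmOrSkew hΛ A B).1 K * F K =
      E.proj J K
        (liftBracket (fun L => F L * A.1 L * F L) (fun L => F L * B.1 L * F L) K) := by
  have htangent (A : Sections ((E.twist S).fiber J)) :
      anchorMap (F K) K (A.1 K) ∈ tangent K :=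
    hF.anchorMap_mem_tangent K ((E.twist S).fiber_le_skew J K (A.2.2 K))
  rw [twistedBracket_apply, hF.mul_proj_mul, mul_sub, sub_mul,
    hF.mul_halfBracket_mul B.2.1 (htangent A) (hΛ.tderiv_eq A K),
    hF.mul_halfBracket_mul A.2.1 (htangent B) (hΛ.tderiv_eq B K), anchorMap_apply,
    anchorMap_apply, sub_sub_sub_comm, liftBracket, ← Ring.lie_def]

theorem isSkewAlgebroid (hF : IsTwisting S J F) (hT : (E.twist S).IsSigned)
    (hE : E.IsLiftClosed J) (hΛ : IsLeftFactor ((E.twist S).fiber J) F Λ) :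
    IsSkewAlgebroid ((E.twist S).fiber J) (twistedBracket hT hF.toIsSymmOrSkew hΛ)
      (anchor ((E.twist S).fiber J) F) where
  subbundle := hT.isSubbundle_fiber J
  anchor_tangent K a := hF.anchorMap_mem_tangent K ((E.twist S).fiber_le_skew J K a.2)
  anchor_smooth A := hF.smooth_anchorMap A.2.1
  skew_symm := twistedBracket_skew hT hF.toIsSymmOrSkew hΛ
  anchor_bracket A B K := by
    let lift (C : Sections ((E.twist S).fiber J)) : Sections (E.fiber J) :=
      ⟨fun L => F L * C.1 L * F L, hF.smooth_mul_mul C.2.1,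
        fun L => hF.mul_mul_mem_fiber L (C.2.2 L)⟩
    have htangent (C : Sections ((E.twist S).fiber J)) :
        ⁅(lift C).1 K, (K : V →L[ℝ] V)⁆ ∈ tangent K :=
      lie_mem_tangent K (E.fiber_le_skew J K ((lift C).2.2 K))
    calc applyAnchor (anchor _ F) (twistedBracket hT hF.toIsSymmOrSkew hΛ A B) K
        = ⁅E.proj J K (liftBracket (lift A).1 (lift B).1 K), (K : V →L[ℝ] V)⁆ :=
          congrArg (⁅·, (K : V →L[ℝ] V)⁆) (hF.mul_twistedBracket_mul hT hΛ A B K)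
      _ = ⁅liftBracket (lift A).1 (lift B).1 K, (K : V →L[ℝ] V)⁆ := hE (lift A) (lift B) K
      _ = lieBracket (applyAnchor (anchor _ F) A) (applyAnchor (anchor _ F) B) K :=
          (lieBracket_lie_coe (lift A).2.1 (lift B).2.1 K (htangent A) (htangent B)).symm
  leibniz A B _ hf K := twistedBracket_fsmul hT hF.toIsSymmOrSkew hΛ A B hf K

end IsTwisting

end TwistedBracket

section LeftFactor

variable {V : Type*} [NormedAddCommGroup V] [InnerProductSpace ℝ V]

/-- The endomorphism `Λ_A = dQ_{[S A S, φ]} Q + M_A S Q²`, with `M_A = S.quadFactor J K A`, which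
serves as left factor of `F = Q S`. -/
noncomputable def leftFactor (S : SType) (J : TwistorSpace V) (Q : TwistorSpace V → (V →L[ℝ] V))
    (K : TwistorSpace V) : (V →L[ℝ] V) →ₗ[ℝ] (V →L[ℝ] V) :=
  LinearMap.mulRight ℝ (Q K) ∘ₗ
      (fderivWithin ℝ (Function.extend Subtype.val Q 0) (twistorSet V) K).toLinearMap ∘ₗ
      anchorMap (S.eval J K) K +
    LinearMap.mulRight ℝ (S.eval J K * Q K * Q K) ∘ₗ S.quadFactor J K

theorem leftFactor_apply (S : SType) (J : TwistorSpace V) (Q : TwistorSpace V → (V →L[ℝ] V))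
    (K : TwistorSpace V) (A : V →L[ℝ] V) :
    leftFactor S J Q K A = tderiv Q K (anchorMap (S.eval J K) K A) * Q K +
      S.quadFactor J K A * (S.eval J K * Q K * Q K) := rfl

theorem leibniz_eq_mul_of_commute {R : Type*} [Ring R] {q s D M : R} (hqs : Commute q s)
    (hD : D * s + q * (s * M * s) = s * M * s * q + s * D) :
    q * D * q * s + q * (q * s * M * (q * s)) = q * s * (D * q + M * (s * q * q)) :=
  calc q * D * q * s + q * (q * s * M * (q * s))
      = q * (D * s + q * (s * M * s)) * q := by
        rw [mul_assoc (q * D), hqs.eq]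
        noncomm_ring
        rw [hqs.symm.left_comm]
    _ = q * (s * M * s * q + s * D) * q := by rw [hD]
    _ = q * s * (D * q + M * (s * q * q)) := by noncomm_ring

variable [FiniteDimensional ℝ V] {S : SType} {J : TwistorSpace V}
variable {Q : TwistorSpace V → (V →L[ℝ] V)}

theorem IsTwisting.tderiv_mul_eval (hF : IsTwisting S J fun K => Q K * S.eval J K)
    (hQ : Smooth Q) (hQJ : ∀ K, Commute (Q K) J) (hQK : ∀ K, Commute (Q K) K)
    {K : TwistorSpace V} {A : V →L[ℝ] V} (hA : A ∈ skew V)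
    (hd : tderiv Q K (anchorMap (Q K * S.eval J K) K A) =
      Q K * tderiv Q K (anchorMap (S.eval J K) K A) * Q K) :
    tderiv (fun L => Q L * S.eval J L) K (anchorMap (Q K * S.eval J K) K A) =
      Q K * S.eval J K * leftFactor S J Q K A := by
  have hS := S.isTwisting_eval J
  have hQS L : Commute (Q L) (S.eval J L) := S.commute_eval (hQJ L) (hQK L)
  -- The two Leibniz expansions of `d(QS) = d(SQ)` along `[S A S, φ]`.
  have hcomm : tderiv Q K (anchorMap (S.eval J K) K A) * S.eval J K +
        Q K * (S.eval J K * S.quadFactor J K A * S.eval J K) =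
      S.eval J K * S.quadFactor J K A * S.eval J K * Q K +
        S.eval J K * tderiv Q K (anchorMap (S.eval J K) K A) := by
    have htangent := hS.anchorMap_mem_tangent K hA
    rw [← hS.tderiv_eval K hA, ← tderiv_mul htangent hQ hS.smooth,
      ← tderiv_mul htangent hS.smooth hQ, funext fun L => (hQS L).eq]
  rw [tderiv_mul (hF.anchorMap_mem_tangent K hA) hQ hS.smooth, hd, hF.tderiv_eval K hA,
    leftFactor_apply]
  exact leibniz_eq_mul_of_commute (hQS K) hcomm

theorem IsTwisting.isLeftFactor_leftFactor (hF : IsTwisting S J fun K => Q K * S.eval J K)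
    (hQ : Smooth Q) (hQJ : ∀ K, Commute (Q K) J) (hQK : ∀ K, Commute (Q K) K)
    {E : TwistorSpace V → Submodule ℝ (V →L[ℝ] V)} (hE : ∀ K, E K ≤ skew V)
    (hd : ∀ (A : Sections E) K, tderiv Q K (anchorMap (Q K * S.eval J K) K (A.1 K)) =
      Q K * tderiv Q K (anchorMap (S.eval J K) K (A.1 K)) * Q K) :
    IsLeftFactor E (fun K => Q K * S.eval J K) (leftFactor S J Q) where
  smooth A := by
    have hS := (S.isTwisting_eval J).toIsSymmOrSkew
    have hderiv : Smooth fun K => tderiv Q K (anchorMap (S.eval J K) K (A.1 K)) :=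
      hQ.tderiv (hS.smooth_anchorMap A.2.1) fun K =>
        hS.anchorMap_mem_tangent K (hE K (A.2.2 K))
    exact (hderiv.mul hQ).add
      ((S.smooth_quadFactor J A.2.1).mul ((hS.smooth.mul hQ).mul hQ))
  tderiv_eq A K := hF.tderiv_mul_eval hQ hQJ hQK (hE K (A.2.2 K)) (hd A K)

end LeftFactor

theorem BType.isSigned_and_isLiftClosed {V : Type*} [NormedAddCommGroup V]
    [InnerProductSpace ℝ V] [FiniteDimensional ℝ V] (J : TwistorSpace V) {E : BType}
    (hE : E = BType.all ∨ E = BType.oPhi ∨ E = BType.uJ ∨ E = BType.uPhi) :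
    E.IsSigned ∧ E.IsLiftClosed J := by
  rcases hE with rfl | rfl | rfl | rfl
  · exact ⟨trivial, isLiftClosed_all J⟩
  · exact ⟨.inr rfl, isLiftClosed_oPhi J⟩
  · exact ⟨.inl rfl, isLiftClosed_uJ J⟩
  · exact ⟨.inl rfl, isLiftClosed_uPhi J⟩

end Twistor

open Twistor in
theorem theorem4p1 {V : Type*} [NormedAddCommGroup V] [InnerProductSpace ℝ V]
    [FiniteDimensional ℝ V] (hdim : 4 ≤ Module.finrank ℝ V)
    (J : TwistorSpace V) (S : SType) (E : BType)
    (hE : E = BType.all ∨ E = BType.oPhi ∨ E = BType.uJ ∨ E = BType.uPhi)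
    (Q F : TwistorSpace V → (V →L[ℝ] V))
    (hF : ∀ K, F K = Q K * S.eval J K)
    (hQ : Twistor.Smooth Q)
    (hQadj : ∀ K, (Q K : V →ₗ[ℝ] V).IsSymmetric)
    (hQJ : ∀ K, Q K * J = J * Q K)
    (hQphi : ∀ K, Q K * K = K * Q K)
    (hdQ : ∀ (C : Sections ((E.twist S).fiber J)) (K : TwistorSpace V),
      tderiv Q K (applyAnchor (anchor ((E.twist S).fiber J) F) C K) =
        Q K * tderiv Q K (applyAnchor (anchor ((E.twist S).fiber J) (S.eval J)) C K) * Q K) :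
    ∃ br : Sections ((E.twist S).fiber J) →ₗ[ℝ] Sections ((E.twist S).fiber J) →ₗ[ℝ]
        Sections ((E.twist S).fiber J),
      IsSkewAlgebroid ((E.twist S).fiber J) br (anchor ((E.twist S).fiber J) F) := by
  have hQstar K : star (Q K) = Q K :=
    (ContinuousLinearMap.isSelfAdjoint_iff_isSymmetric.2 (hQadj K)).star_eq
  obtain rfl : F = fun K => Q K * S.eval J K := funext hF
  have hTwisting : IsTwisting S J fun K => Q K * S.eval J K :=
    isTwisting_mul hQ hQstar hQJ hQphi
  have hΛ := hTwisting.isLeftFactor_leftFactor hQ hQJ hQphi ((E.twist S).fiber_le_skew J) hdQ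
  obtain ⟨hsigned, hclosed⟩ := BType.isSigned_and_isLiftClosed J hE
  exact ⟨_, hTwisting.isSkewAlgebroid (hsigned.twist S) hclosed hΛ⟩
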